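/- Let $Q\subset\mathbb{R}^d$ be a convex polytope, let $\phi_n:Q\to[0,1]$ be a measurable uncertainty density (fixed, for a given search step $n$), and let $k\in(0,1)$, $\alpha>0$, $k_{prop}>0$ and $U_{\max,i}>0$ for $i=1,\dots,N$. A configuration is a tuple $\mathcal P=(p_1,\dots,p_N)\in Q^N$ with $p_i\neq p_j$ for $i\neq j$, and its Voronoi cells are $V_i(\mathcal P)=\{q\in Q:\ \|q-p_i\|\le\|q-p_j\|\ \text{for all } j\}$. Let $$\mathcal H_n(\mathcal P)=\sum_{i=1}^N\int_{V_i}\phi_n(q)\,\bigl(1-\beta(\|p_i-q\|)\bigr)\,dq,\qquad \beta(r)=1-ke^{-\alpha r^2},$$ and let $\tilde M_{V_i}$ and $\tilde C_{V_i}$ be the mass and the centroid of $V_i$ with respect to the perceived density $\tilde\phi_n(q)=\phi_n(q)\,k e^{-\alpha\|p_i-q\|^2}$. Assume that $\int_{V_i(\mathcal P)}\phi_n\,dq>0$ for every configuration $\mathcal P$ and every $i$, so that these centroids are defined. A critical point of $\mathcal H_n$ is a configuration at which $\mathcal H_n$ (defined by the same formula for all $\mathcal P\in(\mathbb{R}^d)^N$)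 is differentiable with zero derivative. Then the critical points of $\mathcal H_n$ are exactly the centroidal Voronoi configurations with respect to the perceived density, that is, the configurations with $p_i=\tilde C_{V_i}$ for all $i$. Moreover, every solution $\mathcal P(t)$, $t\ge 0$, of the first-order dynamics $\dot p_i=u_i$ with the saturated control law $$u_i=\begin{cases}-k_{prop}(p_i-\tilde C_{V_i}) & \text{if } \|k_{prop}(p_i-\tilde C_{V_i})\|\le U_{\max,i},\\[4pt] -U_{\max,i}\,\dfrac{p_i-\tilde C_{V_i}}{\|p_i-\tilde C_{V_i}\|} & \text{otherwise,}\end{cases}$$ that starts at any configuration $\mathcal P(0)\in Q^N$ (with distinct $p_i(0)$) converges asymptotically to the set of critical points of $\mathcal H_n$: the distance from $\mathcal P(t)$ to this set tends to $0$ as $t\to\infty$. -/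

import Mathlib

open MeasureTheory

namespace MultiRobotSearch

/-- The `d`-dimensional Euclidean space. -/
abbrev Space (d : ℕ) : Type := EuclideanSpace ℝ (Fin d)

/-- A convex polytope: the convex hull of finitely many points. -/
def IsConvexPolytope {d : ℕ} (Q : Set (Space d)) : Prop :=
  ∃ S : Set (Space d), S.Finite ∧ Q = convexHull ℝ S

/-- Robot configurations in `Q ^ N`: every robot is in `Q` and no two robots coincide. -/
def configurations {d : ℕ} (Q : Set (Space d)) (N : ℕ) : Set (Fin N → Space d) :=
  {P | (∀ i, P i ∈ Q) ∧ ∀ i j, i ≠ j → P i ≠ P j}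

/-- The Voronoi cell of the `i`-th robot in `Q`. -/
def voronoiCell {d N : ℕ} (Q : Set (Space d)) (P : Fin N → Space d) (i : Fin N) :
    Set (Space d) :=
  {q | q ∈ Q ∧ ∀ j, ‖q - P i‖ ≤ ‖q - P j‖}

/-- The factor `β(r) = 1 - k e ^ (-α r ^ 2)` by which a search reduces the uncertainty. -/
noncomputable def beta (k α r : ℝ) : ℝ := 1 - k * Real.exp (-α * r ^ 2)

/-- The multi-center objective function `∑ i, ∫_{V_i} φ(q) (1 - β(‖p_i - q‖)) dq`. -/
noncomputable def objective {d N : ℕ} (Q : Set (Space d)) (φ : Space d → ℝ) (k α : ℝ)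
    (P : Fin N → Space d) : ℝ :=
  ∑ i, ∫ q in voronoiCell Q P i, φ q * (1 - beta k α ‖P i - q‖)

/-- The density `φ(q) k e ^ (-α ‖p - q‖ ^ 2)` perceived by a sensor at `p`. -/
noncomputable def perceivedDensity {d : ℕ} (φ : Space d → ℝ) (k α : ℝ) (p q : Space d) : ℝ :=
  φ q * (k * Real.exp (-α * ‖p - q‖ ^ 2))

/-- The mass of the `i`-th Voronoi cell with respect to the perceived density. -/
noncomputable def cellMass {d N : ℕ} (Q : Set (Space d)) (φ : Space d → ℝ) (k α : ℝ)
    (P : Fin N → Space d) (i : Fin N) : ℝ :=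
  ∫ q in voronoiCell Q P i, perceivedDensity φ k α (P i) q

/-- The centroid of the `i`-th Voronoi cell with respect to the perceived density
(meaningful when the mass of the cell is positive). -/
noncomputable def cellCentroid {d N : ℕ} (Q : Set (Space d)) (φ : Space d → ℝ) (k α : ℝ)
    (P : Fin N → Space d) (i : Fin N) : Space d :=
  (cellMass Q φ k α P i)⁻¹ •
    ∫ q in voronoiCell Q P i, perceivedDensity φ k α (P i) q • q

/-- The control law with saturation on speed, for a robot at `p`, target `c`, gain `kprop` and
maximum speed `Umax`. -/
noncomputable def saturatedControl {d : ℕ} (kprop Umax : ℝ) (p c : Space d) : Space d :=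
  open Classical in
  if ‖-kprop • (p - c)‖ ≤ Umax then -kprop • (p - c) else -(Umax / ‖p - c‖) • (p - c)

/-- `P` is a trajectory on `[0, ∞)` of the first-order dynamics `ṗ_i = u_i` in closed loop with
the saturated control law towards the centroids. -/
def IsSaturatedTrajectory {d N : ℕ} (Q : Set (Space d)) (φ : Space d → ℝ) (k α kprop : ℝ)
    (Umax : Fin N → ℝ) (P : ℝ → Fin N → Space d) : Prop :=
  ∀ t : ℝ, 0 ≤ t → ∀ i, HasDerivWithinAt (fun s => P s i)
    (saturatedControl kprop (Umax i) (P t i) (cellCentroid Q φ k α (P t) i)) (Set.Ici 0) t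

/-- The critical points of the objective function: the configurations at which it is
differentiable with zero derivative, as a function of all robot positions. -/
def criticalPoints {d : ℕ} (Q : Set (Space d)) (N : ℕ) (φ : Space d → ℝ) (k α : ℝ) :
    Set (Fin N → Space d) :=
  {P | P ∈ configurations Q N ∧
    HasFDerivAt (objective Q φ k α) (0 : (Fin N → Space d) →L[ℝ] ℝ) P}

/-- The centroidal Voronoi configurations with respect to the perceived density. -/
def centroidalConfigurations {d : ℕ} (Q : Set (Space d)) (N : ℕ) (φ : Space d → ℝ) (k α : ℝ) :
    Set (Fin N → Space d) :=
  {P | P ∈ configurations Q N ∧ ∀ i, P i = cellCentroid Q φ k α P i}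

/-- `x(t)` converges to the set `S` as `t → ∞`: its distance to `S` tends to zero
(in particular `S` is nonempty). -/
def ConvergesToSet {X : Type*} [PseudoMetricSpace X] (x : ℝ → X) (S : Set X) : Prop :=
  ∀ ε : ℝ, 0 < ε → ∃ T : ℝ, ∀ t : ℝ, T ≤ t → ∃ y ∈ S, dist (x t) y < ε

end MultiRobotSearch

set_option linter.unusedSectionVars false

/-! Let `μ` be the measure with density `φ` on `Q` and `w x = k * exp (-α * ‖x‖ ^ 2)`. Since `w`
decreases with distance, the weight of the owner of a cell is the largest one there, so for distinct
points the objective is `∫ maxᵢ w (pᵢ - q) dμ` (`sum_mass_eq_coverage`). By the envelope principle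
moving cell boundaries contribute nothing, and the gradient in `pᵢ` is `2 * α` times the moment `Mᵢ
• (Cᵢ - pᵢ)` (`hasFDerivAt_coverage`, `moment_eq`). As `Mᵢ > 0`, critical means centroidal.

Saturation turns the control into `sᵢ • (Cᵢ - pᵢ)` with gains between two positive constants, so
coverage increases along trajectories at a rate controlled by the moments. Being bounded, it forces
limit points to be stationary, as in LaSalle's principle. The obstacle is that configurations
without collisions are not compact.

Collisions in finite time are excluded because each centroid lies on its generator's side of every
bisector, so distances decay at most exponentially (`exp_mul_norm_sq_le`). This also provides the
positive masses that keep centroids defined. Collisions in the limit are excluded by repulsion: near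
a collided limit, some cell of the cluster has mass bounded below (`exists_le_measure_cell`), hence
its centroid lies a definite distance beyond each of its bisectors (`exists_le_inner_centroid`). The
sum of distances within the cluster then grows at a definite rate and cannot tend to zero
(`injective_of_tendsto`). -/

namespace MultiRobotSearch

open Filter Topology

/-! ### The Gaussian weight and its Lipschitz bound -/

section Weight

variable {E : Type*} [NormedAddCommGroup E]

/-- The Gaussian detection weight `k e ^ (-α ‖x‖ ^ 2)`. -/
noncomputable def weight (k α : ℝ) (x : E) : ℝ := k * Real.exp (-α * ‖x‖ ^ 2)

theorem weight_pos {k α : ℝ} (hk : 0 < k) (x : E) : 0 < weight k α x := by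
  unfold weight; positivity

theorem weight_le {k α : ℝ} (hk : 0 < k) (hα : 0 < α) (x : E) : weight k α x ≤ k := by
  unfold weight
  have : Real.exp (-α * ‖x‖ ^ 2) ≤ 1 := by
    rw [Real.exp_le_one_iff]
    nlinarith [sq_nonneg ‖x‖]
  nlinarith

theorem weight_le_weight {k α : ℝ} (hk : 0 < k) (hα : 0 < α) {x y : E} (h : ‖x‖ ≤ ‖y‖) :
    weight k α y ≤ weight k α x := by
  unfold weight
  have : ‖x‖ ^ 2 ≤ ‖y‖ ^ 2 := by gcongr
  gcongr ?_ * Real.exp ?_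
  nlinarith

theorem continuous_weight (k α : ℝ) : Continuous (weight k α : E → ℝ) := by
  unfold weight; fun_prop

variable [InnerProductSpace ℝ E]

theorem hasFDerivAt_weight (k α : ℝ) (x : E) :
    HasFDerivAt (weight k α) (-(2 * α * weight k α x) • innerSL ℝ x) x := by
  have h1 : HasFDerivAt (fun y : E => ‖y‖ ^ 2) (2 • innerSL ℝ x) x :=
    (hasStrictFDerivAt_norm_sq x).hasFDerivAt
  have h2 := ((h1.const_mul (-α)).exp).const_mul k
  refine h2.congr_fderiv ?_
  ext y
  simp only [weight, smul_apply, innerSL_apply_apply, smul_eq_mul, nsmul_eq_mul]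
  push_cast
  ring

theorem norm_fderiv_weight_le {k α : ℝ} (hk : 0 < k) (hα : 0 < α) (x : E) :
    ‖fderiv ℝ (weight k α) x‖ ≤ 2 * k * (α + 1) := by
  rw [(hasFDerivAt_weight k α x).fderiv, norm_smul, innerSL_apply_norm]
  have hw := weight_pos (α := α) hk x
  rw [norm_neg, Real.norm_of_nonneg (by positivity)]
  -- The exponential beats the quadratic: `w * α * ‖x‖ ^ 2 ≤ w * exp (α * ‖x‖ ^ 2) = k`, and `‖x‖ ≤
  -- 1 + ‖x‖ ^ 2` reduces the linear factor to this case.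
  have h1 := Real.add_one_le_exp (α * ‖x‖ ^ 2)
  have h3 : weight k α x * Real.exp (α * ‖x‖ ^ 2) = k := by
    unfold weight
    rw [mul_assoc, ← Real.exp_add]
    simp
  have h4 : weight k α x * (α * ‖x‖ ^ 2) ≤ k := by nlinarith
  have h5 := weight_le hk hα x
  have h6 : ‖x‖ ≤ 1 + ‖x‖ ^ 2 := by nlinarith [sq_nonneg (‖x‖ - 1), norm_nonneg x]
  have h7 : weight k α x * α * ‖x‖ ≤ weight k α x * α * (1 + ‖x‖ ^ 2) := by gcongr
  nlinarith

theorem lipschitzWith_weight {k α : ℝ} (hk : 0 < k) (hα : 0 < α) :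
    LipschitzWith (Real.toNNReal (2 * k * (α + 1))) (weight k α : E → ℝ) := by
  refine lipschitzWith_of_nnnorm_fderiv_le (𝕜 := ℝ)
    (fun x => (hasFDerivAt_weight k α x).differentiableAt) fun x => ?_
  rw [← NNReal.coe_le_coe, coe_nnnorm, Real.coe_toNNReal _ (by positivity)]
  exact norm_fderiv_weight_le hk hα x

end Weight

/-! ### Voronoi cells and continuity of integrals over them -/

section Cell

variable {E : Type*} [NormedAddCommGroup E] {ι : Type*}

/-- The Voronoi cell of the `i`-th point in the whole space. -/
def cell (P : ι → E) (i : ι) : Set E := {q | ∀ j, ‖q - P i‖ ≤ ‖q - P j‖}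

theorem isClosed_cell (P : ι → E) (i : ι) : IsClosed (cell P i) := by
  have : cell P i = ⋂ j, {q | ‖q - P i‖ ≤ ‖q - P j‖} := by ext; simp [cell]
  rw [this]
  exact isClosed_iInter fun j => isClosed_le (by fun_prop) (by fun_prop)

theorem measurableSet_cell [MeasurableSpace E] [BorelSpace E] (P : ι → E) (i : ι) :
    MeasurableSet (cell P i) := (isClosed_cell P i).measurableSet

theorem exists_mem_cell [Finite ι] [Nonempty ι] (P : ι → E) (q : E) : ∃ i, q ∈ cell P i :=
  Finite.exists_min fun i => ‖q - P i‖

/-- Points of a cell lie on the side of the cell's generator of each bisector. -/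
theorem inner_midpoint_nonneg [InnerProductSpace ℝ E] {P : ι → E} {i : ι} {q : E} (hq : q ∈ cell P i) (j : ι) :
    0 ≤ inner ℝ (P i - P j) (q - (2⁻¹ : ℝ) • (P i + P j)) := by
  have h := hq j
  have h2 : ‖q - P i‖ ^ 2 ≤ ‖q - P j‖ ^ 2 := by gcongr
  rw [@norm_sub_sq_real, @norm_sub_sq_real] at h2
  simp only [inner_sub_left, inner_sub_right, inner_smul_right, inner_add_right,
    real_inner_self_eq_norm_sq]
  rw [real_inner_comm q (P i), real_inner_comm q (P j), real_inner_comm (P i) (P j)]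
  linarith

/-- Off the bisectors all the distance comparisons are strict, hence stable under small
perturbations of the generators. -/
theorem eventually_mem_cell_iff [Finite ι] {P : ι → E} {q : E}
    (hq : ∀ i j, i ≠ j → ‖q - P i‖ ≠ ‖q - P j‖) (i : ι) :
    ∀ᶠ P' in 𝓝 P, (q ∈ cell P' i ↔ q ∈ cell P i) := by
  have hlt : ∀ a b, ‖q - P a‖ < ‖q - P b‖ → ∀ᶠ P' in 𝓝 P, ‖q - P' a‖ < ‖q - P' b‖ := by
    intro a b hab
    have h1 : Continuous fun P' : ι → E => ‖q - P' a‖ := by fun_prop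
    have h2 : Continuous fun P' : ι → E => ‖q - P' b‖ := by fun_prop
    exact (isOpen_lt h1 h2).mem_nhds hab
  by_cases h : q ∈ cell P i
  · have : ∀ᶠ P' in 𝓝 P, ∀ j, ‖q - P' i‖ ≤ ‖q - P' j‖ := by
      rw [eventually_all]
      intro j
      rcases eq_or_ne i j with rfl | hij
      · simp
      · exact (hlt i j (lt_of_le_of_ne (h j) (hq i j hij))).mono fun _ h => h.le
    filter_upwards [this] with P' hP'
    exact ⟨fun _ => h, fun _ => hP'⟩
  · have h' : ∃ j, ‖q - P j‖ < ‖q - P i‖ := by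
      simpa [cell] using h
    obtain ⟨j, hj⟩ := h'
    filter_upwards [hlt j i hj] with P' hP'
    exact ⟨fun h2 => absurd (h2 j) (not_le.2 hP'), fun h2 => absurd h2 h⟩

variable [MeasurableSpace E]

/-- The points equidistant from two distinct points form a null set. -/
def BisectorsNull (μ : Measure E) : Prop := ∀ x y : E, x ≠ y → μ {q | ‖q - x‖ = ‖q - y‖} = 0

theorem BisectorsNull.ae_ne [Countable ι] {μ : Measure E} (hμ : BisectorsNull μ) {P : ι → E}
    (hP : Function.Injective P) : ∀ᵐ q ∂μ, ∀ i j, i ≠ j → ‖q - P i‖ ≠ ‖q - P j‖ := by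
  rw [ae_all_iff]; intro i
  rw [ae_all_iff]; intro j
  by_cases h : i = j
  · simp [h]
  · have := hμ _ _ (hP.ne h)
    rw [ae_iff]
    simpa [h] using this

theorem BisectorsNull.ae_existsUnique [Finite ι] [Nonempty ι] {μ : Measure E}
    (hμ : BisectorsNull μ) {P : ι → E} (hP : Function.Injective P) :
    ∀ᵐ q ∂μ, ∃ i, q ∈ cell P i ∧ ∀ j, j ≠ i → q ∉ cell P j := by
  filter_upwards [hμ.ae_ne hP] with q hq
  obtain ⟨i, hi⟩ := exists_mem_cell P q
  exact ⟨i, hi, fun j hj hqj => hq i j hj.symm (le_antisymm (hi j) (hqj i))⟩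

variable [BorelSpace E] [SecondCountableTopology E] {F : Type*} [NormedAddCommGroup F]
  {μ : Measure E} [IsFiniteMeasure μ] {K : Set E}

theorem integrable_of_continuous_of_compact (hK : IsCompact K) (hKμ : ∀ᵐ q ∂μ, q ∈ K) {g : E → F}
    (hg : Continuous g) : Integrable g μ := by
  obtain ⟨C, hC⟩ := hK.exists_bound_of_continuousOn hg.continuousOn
  refine Integrable.of_bound hg.aestronglyMeasurable C ?_
  filter_upwards [hKμ] with q hq using hC q hq

variable [NormedSpace ℝ F]

/-- Dominated convergence: for almost every `q`, membership in the cell is locally constant in the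
generators. Injectivity is needed because the bisector of coinciding points is the whole space. -/
theorem continuousAt_integral_cell [Fintype ι] [ProperSpace E] (hμ : BisectorsNull μ)
    (hK : IsCompact K)
    (hKμ : ∀ᵐ q ∂μ, q ∈ K) {g : E → E → F} (hg : Continuous (Function.uncurry g)) {P : ι → E}
    (hP : Function.Injective P) (i : ι) :
    ContinuousAt (fun P' : ι → E => ∫ q in cell P' i, g (P' i) q ∂μ) P := by
  simp only [← integral_indicator (measurableSet_cell _ _)]
  have hcpt : IsCompact (Metric.closedBall (P i) 1 ×ˢ K) :=
    (isCompact_closedBall (P i) 1).prod hK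
  obtain ⟨C, hC⟩ := hcpt.exists_bound_of_continuousOn hg.continuousOn
  have hev : Continuous fun P' : ι → E => P' i := by fun_prop
  refine tendsto_integral_filter_of_dominated_convergence (fun _ => C) ?_ ?_ (by simp) ?_
  · refine Eventually.of_forall fun P' => ?_
    exact ((hg.comp (Continuous.prodMk_right (P' i))).aestronglyMeasurable).indicator
      (measurableSet_cell _ _)
  · have : ∀ᶠ P' in 𝓝 P, P' i ∈ Metric.closedBall (P i) 1 :=
      hev.continuousAt.eventually (Metric.closedBall_mem_nhds _ one_pos)
    filter_upwards [this] with P' hP'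
    filter_upwards [hKμ] with q hq
    exact (norm_indicator_le_norm_self _ _).trans (hC (P' i, q) ⟨hP', hq⟩)
  · filter_upwards [hμ.ae_ne hP] with q hq
    have h1 : Tendsto (fun P' : ι → E => g (P' i) q) (𝓝 P) (𝓝 (g (P i) q)) :=
      (hg.comp (hev.prodMk continuous_const)).tendsto P
    by_cases h : q ∈ cell P i
    · rw [Set.indicator_of_mem h]
      refine h1.congr' ?_
      filter_upwards [eventually_mem_cell_iff hq i] with P' hP'
      rw [Set.indicator_of_mem (hP'.2 h)]
    · rw [Set.indicator_of_notMem h]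
      refine tendsto_const_nhds.congr' ?_
      filter_upwards [eventually_mem_cell_iff hq i] with P' hP'
      rw [Set.indicator_of_notMem (fun h' => h (hP'.1 h'))]

end Cell

theorem integrable_weight {E : Type*} [NormedAddCommGroup E] [MeasurableSpace E] [BorelSpace E]
    {μ : Measure E} [IsFiniteMeasure μ] {k α : ℝ} (hk : 0 < k) (hα : 0 < α) (p : E) :
    Integrable (fun q => weight k α (p - q)) μ := by
  refine Integrable.of_bound (C := k)
    ((continuous_weight k α).comp (by fun_prop)).aestronglyMeasurable ?_
  refine Eventually.of_forall fun q => ?_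
  rw [Real.norm_of_nonneg (weight_pos hk _).le]
  exact weight_le hk hα _

theorem iSup_weight_eq {E ι : Type*} [NormedAddCommGroup E] [Finite ι] [Nonempty ι] {k α : ℝ}
    (hk : 0 < k) (hα : 0 < α) {P : ι → E} {q : E} {i : ι}
    (hi : q ∈ cell P i) : ⨆ j, weight k α (P j - q) = weight k α (P i - q) := by
  refine le_antisymm (ciSup_le fun j => weight_le_weight hk hα ?_)
    (le_ciSup (f := fun j => weight k α (P j - q)) (Set.finite_range _).bddAbove i)
  rw [norm_sub_rev, norm_sub_rev (P j)]
  exact hi j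

/-! ### Masses, centroids and moments of cells -/

section Moments

variable {E : Type*} [NormedAddCommGroup E] [InnerProductSpace ℝ E] {ι : Type*}
  [MeasurableSpace E]

/-- The mass of the `i`-th cell with respect to the Gaussian weight. -/
noncomputable def mass (μ : Measure E) (k α : ℝ) (P : ι → E) (i : ι) : ℝ :=
  ∫ q in cell P i, weight k α (P i - q) ∂μ

/-- The centroid of the `i`-th cell with respect to the Gaussian weight. -/
noncomputable def centroid (μ : Measure E) (k α : ℝ) (P : ι → E) (i : ι) : E :=
  (mass μ k α P i)⁻¹ • ∫ q in cell P i, weight k α (P i - q) • q ∂μ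

/-- The first moment of the `i`-th cell about its generator. -/
noncomputable def moment (μ : Measure E) (k α : ℝ) (P : ι → E) (i : ι) : E :=
  ∫ q in cell P i, weight k α (P i - q) • (q - P i) ∂μ

/-- The coverage functional `∫ maxᵢ w (pᵢ - q) dμ`. -/
noncomputable def coverage (μ : Measure E) (k α : ℝ) (P : ι → E) : ℝ :=
  ∫ q, ⨆ i, weight k α (P i - q) ∂μ

variable [BorelSpace E] [FiniteDimensional ℝ E]
  {μ : Measure E} [IsFiniteMeasure μ] {K : Set E} {k α : ℝ}

theorem mass_le (hk : 0 < k) (hα : 0 < α) (P : ι → E) (i : ι) :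
    mass μ k α P i ≤ k * μ.real Set.univ := by
  have h1 : mass μ k α P i ≤ ∫ q, weight k α (P i - q) ∂μ :=
    setIntegral_le_integral (integrable_weight hk hα _)
      (Eventually.of_forall fun q => (weight_pos hk _).le)
  have h2 : ∫ q, weight k α (P i - q) ∂μ ≤ ∫ _, k ∂μ :=
    integral_mono (integrable_weight hk hα _) (integrable_const _) fun q => weight_le hk hα _
  rw [integral_const, smul_eq_mul, mul_comm] at h2
  exact h1.trans h2

theorem mass_pos (hk : 0 < k) (hα : 0 < α) {P : ι → E} {i : ι} (h : 0 < μ.real (cell P i)) :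
    0 < mass μ k α P i := by
  unfold mass
  rw [setIntegral_pos_iff_support_of_nonneg_ae
    (Eventually.of_forall fun q => (weight_pos hk _).le) (integrable_weight hk hα _).integrableOn]
  have : Function.support (fun q => weight k α (P i - q)) = Set.univ := by
    ext q; simpa using (weight_pos hk _).ne'
  rw [this, Set.univ_inter]
  exact (ENNReal.toReal_pos_iff.1 h).1

variable (hK : IsCompact K) (hKμ : ∀ᵐ q ∂μ, q ∈ K)
include hK hKμ

theorem moment_eq {P : ι → E} {i : ι} (h : mass μ k α P i ≠ 0) :
    moment μ k α P i = mass μ k α P i • (centroid μ k α P i - P i) := by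
  have hw : Continuous fun q : E => weight k α (P i - q) :=
    (continuous_weight k α).comp (by fun_prop)
  have h1 : Integrable (fun q => weight k α (P i - q) • q) μ :=
    integrable_of_continuous_of_compact hK hKμ (by fun_prop)
  have h2 : Integrable (fun q => weight k α (P i - q) • P i) μ :=
    integrable_of_continuous_of_compact hK hKμ (by fun_prop)
  unfold moment centroid
  simp only [smul_sub]
  rw [integral_sub h1.integrableOn h2.integrableOn, integral_smul_const, smul_inv_smul₀ h, mass]

/-- The deviation of a linear functional at the centroid from a constant, as an integral. -/
theorem mass_mul_centroid_sub {P : ι → E} {i : ι} (h : mass μ k α P i ≠ 0) (l : E →L[ℝ] ℝ)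
    (b : ℝ) : mass μ k α P i * (l (centroid μ k α P i) - b) =
      ∫ q in cell P i, weight k α (P i - q) * (l q - b) ∂μ := by
  have hw : Continuous fun q : E => weight k α (P i - q) :=
    (continuous_weight k α).comp (by fun_prop)
  have h1 : Integrable (fun q => weight k α (P i - q) • q) μ :=
    integrable_of_continuous_of_compact hK hKμ (by fun_prop)
  have h2 : Integrable (fun q => weight k α (P i - q) * b) μ :=
    integrable_of_continuous_of_compact hK hKμ (by fun_prop)
  have h3 : Integrable (fun q => weight k α (P i - q) * l q) μ :=
    integrable_of_continuous_of_compact hK hKμ (by fun_prop)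
  simp only [mul_sub]
  rw [integral_sub h3.integrableOn h2.integrableOn, integral_mul_const, centroid, map_smul,
    smul_eq_mul, mul_inv_cancel_left₀ h, ← l.integral_comp_comm h1.integrableOn, mass]
  simp

/-- A weighted average inherits affine lower bounds. Separating functionals then place the centroid
in `K`, and bisectors place it on its generator's side. -/
theorem le_centroid (hk : 0 < k) {P : ι → E} {i : ι} (h : 0 < mass μ k α P i)
    (l : E →L[ℝ] ℝ) (b : ℝ) (hl : ∀ q ∈ K, q ∈ cell P i → b ≤ l q) :
    b ≤ l (centroid μ k α P i) := by
  have h1 := mass_mul_centroid_sub hK hKμ h.ne' l b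
  have h2 : 0 ≤ ∫ q in cell P i, weight k α (P i - q) * (l q - b) ∂μ := by
    refine integral_nonneg_of_ae ?_
    filter_upwards [ae_restrict_of_ae hKμ, ae_restrict_mem (measurableSet_cell P i)] with q hq hqc
    exact mul_nonneg (weight_pos hk _).le (sub_nonneg.2 (hl q hq hqc))
  rw [← h1] at h2
  linarith [nonneg_of_mul_nonneg_right h2 h]

theorem centroid_mem (hconv : Convex ℝ K) (hk : 0 < k) {P : ι → E} {i : ι}
    (h : 0 < mass μ k α P i) : centroid μ k α P i ∈ K := by
  by_contra hc
  obtain ⟨f, u, hf, hu⟩ := geometric_hahn_banach_closed_point hconv hK.isClosed hc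
  have := le_centroid hK hKμ hk h (-f) (-u) (fun q hq _ => by simpa using (hf q hq).le)
  simp only [neg_apply] at this
  linarith

/-- The centroid of a cell lies on the generator's side of every bisector. -/
theorem inner_centroid_nonneg (hk : 0 < k) {P : ι → E} {i : ι} (h : 0 < mass μ k α P i) (j : ι) :
    0 ≤ inner ℝ (P i - P j) (centroid μ k α P i - (2⁻¹ : ℝ) • (P i + P j)) := by
  have := le_centroid hK hKμ hk h (innerSL ℝ (P i - P j))
    (inner ℝ (P i - P j) ((2⁻¹ : ℝ) • (P i + P j))) fun q _ hqc => by
      have := inner_midpoint_nonneg hqc j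
      rw [inner_sub_right] at this
      rw [innerSL_apply_apply]
      linarith
  rw [innerSL_apply_apply] at this
  rw [inner_sub_right]
  linarith

variable [Fintype ι] (hμ : BisectorsNull μ)
include hμ

theorem continuousAt_mass {P : ι → E} (hP : Function.Injective P) (i : ι) :
    ContinuousAt (fun P' => mass μ k α P' i) P := by
  have : Continuous (weight k α : E → ℝ) := continuous_weight k α
  exact continuousAt_integral_cell hμ hK hKμ
    (g := fun p q => weight k α (p - q)) (by fun_prop) hP i

theorem continuousAt_moment {P : ι → E} (hP : Function.Injective P) (i : ι) :
    ContinuousAt (fun P' => moment μ k α P' i) P := by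
  have : Continuous (weight k α : E → ℝ) := continuous_weight k α
  exact continuousAt_integral_cell hμ hK hKμ
    (g := fun p q => weight k α (p - q) • (q - p)) (by fun_prop) hP i

end Moments

theorem integrable_sum_indicator {X F ι : Type*} [MeasurableSpace X] [Fintype ι]
    [NormedAddCommGroup F] {μ : Measure X} {A : ι → X → F} {C : ι → Set X}
    (hA : ∀ i, Integrable (A i) μ) (hC : ∀ i, MeasurableSet (C i)) :
    Integrable (fun x => ∑ i, (C i).indicator (A i) x) μ :=
  integrable_finsetSum _ fun i _ => (hA i).indicator (hC i)

/-! ### The coverage functional and its gradient -/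

section Coverage

variable {E : Type*} [NormedAddCommGroup E] [InnerProductSpace ℝ E] {ι : Type*}
  [MeasurableSpace E] [BorelSpace E] [FiniteDimensional ℝ E] [Fintype ι]
  {μ : Measure E} [IsFiniteMeasure μ] {K : Set E} {k α : ℝ}

/-- Almost every point lies in exactly one cell, whose generator attains the supremum. Coinciding
generators would count their common cell repeatedly. -/
theorem sum_mass_eq_coverage (hk : 0 < k) (hα : 0 < α) (hμ : BisectorsNull μ) {P : ι → E}
    (hP : Function.Injective P) : ∑ i, mass μ k α P i = coverage μ k α P := by
  rcases isEmpty_or_nonempty ι with hι | hι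
  · simp [coverage]
  unfold mass coverage
  simp only [← integral_indicator (measurableSet_cell P _)]
  rw [← integral_finsetSum _ fun i _ =>
    (integrable_weight hk hα (P i)).indicator (measurableSet_cell P i)]
  refine integral_congr_ae ?_
  filter_upwards [hμ.ae_existsUnique hP] with q ⟨i, hi, hi'⟩
  rw [iSup_weight_eq hk hα hi, Finset.sum_eq_single i]
  · rw [Set.indicator_of_mem hi]
  · intro j _ hj
    rw [Set.indicator_of_notMem (hi' j hj)]
  · simp

/-- Envelope principle: a supremum of uniformly Lipschitz functions is Lipschitz, and off the
bisectors it coincides locally with the function of the nearest generator, so one may differentiate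
under the integral. -/
theorem hasFDerivAt_coverage_comp {X : Type*} [NormedAddCommGroup X] [NormedSpace ℝ X]
    [Nonempty ι] (hk : 0 < k) (hα : 0 < α) (hK : IsCompact K)
    (hKμ : ∀ᵐ q ∂μ, q ∈ K) (hμ : BisectorsNull μ) (pr : ι → X →L[ℝ] E) (hpr : ∀ i, ‖pr i‖ ≤ 1)
    {P : X} (hP : Function.Injective fun i => pr i P) :
    HasFDerivAt (fun x => coverage μ k α fun i => pr i x)
      (∑ i, ((2 * α) • innerSL ℝ (moment μ k α (fun i => pr i P) i)).comp (pr i)) P := by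
  have hw : Continuous (weight k α : E → ℝ) := continuous_weight k α
  let C : ι → Set E := cell fun i => pr i P
  have hC : ∀ i, MeasurableSet (C i) := measurableSet_cell _
  let A : ι → E → X →L[ℝ] ℝ := fun i q =>
    ((2 * α * weight k α (pr i P - q)) • innerSL ℝ (q - pr i P)).comp (pr i)
  have hA : ∀ i, Continuous (A i) := fun i => by
    have : Continuous fun q => ((2 * α * weight k α (pr i P - q)) • innerSL ℝ (q - pr i P)) := by
      fun_prop
    exact this.clm_comp continuous_const
  have hAint : ∀ i, Integrable (A i) μ := fun i =>
    integrable_of_continuous_of_compact hK hKμ (hA i)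
  let F' : E → X →L[ℝ] ℝ := fun q => ∑ i, (C i).indicator (A i) q
  have hF'int : Integrable F' μ :=
    integrable_sum_indicator hAint hC
  have hmeas : ∀ x : X, AEStronglyMeasurable (fun q => ⨆ i, weight k α (pr i x - q)) μ := by
    intro x
    refine (Measurable.iSup fun i => ?_).aestronglyMeasurable
    exact (hw.comp (by fun_prop)).measurable
  let F : X → E → ℝ := fun x q => ⨆ i, weight k α (pr i x - q)
  have hFint : Integrable (F P) μ := by
    refine Integrable.of_bound (hmeas P) k (Eventually.of_forall fun q => ?_)
    obtain ⟨i, hi⟩ := exists_mem_cell (fun i => pr i P) q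
    simp only [F]
    rw [iSup_weight_eq hk hα hi, Real.norm_of_nonneg (weight_pos hk _).le]
    exact weight_le hk hα _
  have hlip : ∀ᵐ q ∂μ, LipschitzOnWith (Real.nnabs (2 * k * (α + 1))) (fun x => F x q) Set.univ := by
    refine Eventually.of_forall fun q => LipschitzOnWith.of_le_add_mul _ ?_
    intro P₁ _ P₂ _
    refine ciSup_le fun i => ?_
    have h1 := (lipschitzWith_weight (E := E) hk hα).dist_le_mul (pr i P₁ - q) (pr i P₂ - q)
    rw [Real.dist_eq, dist_sub_right] at h1
    have h2 := le_ciSup (f := fun j => weight k α (pr j P₂ - q)) (Set.finite_range _).bddAbove i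
    have h3 : dist (pr i P₁) (pr i P₂) ≤ dist P₁ P₂ := by
      rw [dist_eq_norm, dist_eq_norm, ← map_sub]
      exact ((pr i).le_of_opNorm_le (hpr i) _).trans_eq (one_mul _)
    rw [Real.coe_toNNReal _ (by positivity)] at h1
    have h4 : 2 * k * (α + 1) * dist (pr i P₁) (pr i P₂) ≤ 2 * k * (α + 1) * dist P₁ P₂ := by
      gcongr
    rw [Real.coe_nnabs, abs_of_pos (by positivity)]
    have h6 := le_abs_self (weight k α (pr i P₁ - q) - weight k α (pr i P₂ - q))
    linarith
  have hder : ∀ᵐ q ∂μ, HasFDerivAt (fun x => F x q) (F' q) P := by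
    filter_upwards [hμ.ae_ne hP] with q hq
    obtain ⟨i, hi⟩ := exists_mem_cell (fun i => pr i P) q
    have h1 : F' q = A i q := by
      simp only [F']
      rw [Finset.sum_eq_single i]
      · rw [Set.indicator_of_mem hi]
      · intro j _ hj
        rw [Set.indicator_of_notMem]
        exact fun hqj => hq i j hj.symm (le_antisymm (hi j) (hqj i))
      · simp
    have h2 : HasFDerivAt (fun x : X => weight k α (pr i x - q)) (A i q) P := by
      have h3 : HasFDerivAt (fun x : X => pr i x - q) (pr i) P :=
        ((pr i).hasFDerivAt).sub_const q
      refine ((hasFDerivAt_weight k α (pr i P - q)).comp P h3).congr_fderiv ?_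
      ext v
      simp only [A, ContinuousLinearMap.comp_apply, smul_apply, innerSL_apply_apply, smul_eq_mul,
        inner_sub_left]
      ring
    rw [h1]
    refine h2.congr_of_eventuallyEq ?_
    have h4 : Continuous fun x i => pr i x := by fun_prop
    filter_upwards [(h4.tendsto P).eventually (eventually_mem_cell_iff hq i)] with x hx
    exact iSup_weight_eq hk hα (hx.2 hi)
  have key : HasFDerivAt (fun x => ∫ q, F x q ∂μ) (∫ q, F' q ∂μ) P :=
    (hasFDerivAt_integral_of_dominated_loc_of_lip (𝕜 := ℝ) univ_mem
      (Eventually.of_forall hmeas) hFint hF'int.aestronglyMeasurable hlip (integrable_const _)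
      hder).2
  refine key.congr_fderiv ?_
  ext v
  rw [ContinuousLinearMap.integral_apply hF'int]
  simp only [F', sum_apply]
  have h1 : ∀ i q, ((C i).indicator (A i) q) v = (C i).indicator (fun q => A i q v) q := by
    intro i q
    by_cases h : q ∈ C i <;> simp [h]
  simp only [h1]
  rw [integral_finsetSum _ fun i _ => ((hAint i).apply_continuousLinearMap v).indicator
    (hC i)]
  refine Finset.sum_congr rfl fun i _ => ?_
  rw [integral_indicator (hC i)]
  have h2 : Integrable (fun q => weight k α (pr i P - q) • (q - pr i P)) μ :=
    integrable_of_continuous_of_compact hK hKμ (by fun_prop)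
  have h3 := integral_inner (𝕜 := ℝ) (μ := μ.restrict (C i)) h2.integrableOn (pr i v)
  simp only [A, moment, ContinuousLinearMap.comp_apply, smul_apply, innerSL_apply_apply,
    smul_eq_mul]
  rw [real_inner_comm, ← h3, ← integral_const_mul]
  refine integral_congr_ae (Eventually.of_forall fun q => ?_)
  simp only [inner_smul_right]
  rw [real_inner_comm]
  ring

theorem hasFDerivAt_coverage (hk : 0 < k) (hα : 0 < α) (hK : IsCompact K)
    (hKμ : ∀ᵐ q ∂μ, q ∈ K) (hμ : BisectorsNull μ) {P : ι → E} (hP : Function.Injective P) :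
    HasFDerivAt (coverage μ k α)
      (∑ i, ((2 * α) • innerSL ℝ (moment μ k α P i)).comp
        (ContinuousLinearMap.proj (R := ℝ) (φ := fun _ : ι => E) i)) P := by
  rcases isEmpty_or_nonempty ι with hι | hι
  · simp only [Finset.univ_eq_empty, Finset.sum_empty]
    exact hasFDerivAt_of_subsingleton _ _
  refine hasFDerivAt_coverage_comp hk hα hK hKμ hμ
    (fun i => ContinuousLinearMap.proj (R := ℝ) (φ := fun _ : ι => E) i) (fun i => ?_) hP
  refine ContinuousLinearMap.opNorm_le_bound _ zero_le_one fun v => ?_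
  rw [one_mul]
  exact norm_le_pi_norm v i

end Coverage

/-! ### Uniform estimates near collisions -/

section Estimates

variable {E : Type*} [NormedAddCommGroup E] [InnerProductSpace ℝ E] {ι : Type*}
  [MeasurableSpace E] [BorelSpace E] [FiniteDimensional ℝ E]
  {μ : Measure E} [IsFiniteMeasure μ] {K : Set E} {k α : ℝ}

/-- The hyperplane through `m` with normal `n` is the bisector of `m + n` and `m - n`. -/
theorem BisectorsNull.hyperplane (hμ : BisectorsNull μ) {n : E} (hn : n ≠ 0) (m : E) :
    μ {q | inner ℝ n (q - m) = 0} = 0 := by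
  have h1 : m + n ≠ m - n := by
    intro h
    have h2 : (2 : ℝ) • n = 0 := by
      rw [two_smul]
      calc n + n = (m + n) - (m - n) := by abel
        _ = 0 := sub_eq_zero.2 h
    exact hn ((smul_eq_zero.1 h2).resolve_left two_ne_zero)
  convert hμ _ _ h1 using 2
  ext q
  simp only [Set.mem_ofPred_eq]
  have h2 : q - (m + n) = (q - m) - n := by abel
  have h3 : q - (m - n) = (q - m) + n := by abel
  rw [h2, h3, ← sq_eq_sq₀ (norm_nonneg _) (norm_nonneg _), norm_sub_sq_real, norm_add_sq_real,
    real_inner_comm]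
  constructor <;> intro h <;> linarith

/-- Thin slabs meeting a compact set have uniformly small measure. -/
theorem exists_slab_lt (hμ : BisectorsNull μ) (hK : IsCompact K) {c : ℝ} (hc : 0 < c) :
    ∃ h > 0, ∀ n m : E, ‖n‖ = 1 → m ∈ K → μ.real {q | |inner ℝ n (q - m)| ≤ h} < c := by
  have hcpt : IsCompact (Metric.sphere (0 : E) 1 ×ˢ K) := (isCompact_sphere 0 1).prod hK
  have hmeas : ∀ z : (E × E) × ℝ, MeasurableSet {q | |inner ℝ z.1.1 (q - z.1.2)| ≤ z.2} :=
    fun z => (isClosed_le (by fun_prop) (by fun_prop)).measurableSet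
  have key : ∀ x ∈ Metric.sphere (0 : E) 1 ×ˢ K, ∀ᶠ z in 𝓝 (x, (0 : ℝ)),
      μ.real {q | |inner ℝ z.1.1 (q - z.1.2)| ≤ z.2} < c := by
    rintro ⟨n, m⟩ ⟨hn, -⟩
    have hn0 : n ≠ 0 := by
      rintro rfl
      simp at hn
    have hlim : Tendsto (fun z : (E × E) × ℝ =>
        ∫ q, {q | |inner ℝ z.1.1 (q - z.1.2)| ≤ z.2}.indicator (fun _ => (1 : ℝ)) q ∂μ)
        (𝓝 ((n, m), 0)) (𝓝 (∫ _, (0 : ℝ) ∂μ)) := by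
      refine tendsto_integral_filter_of_dominated_convergence (fun _ => 1) ?_ ?_
        (integrable_const _) ?_
      · exact Eventually.of_forall fun z =>
          (aestronglyMeasurable_const).indicator (hmeas z)
      · refine Eventually.of_forall fun z => Eventually.of_forall fun q => ?_
        refine (norm_indicator_le_norm_self _ _).trans (by simp)
      · have hae : ∀ᵐ q ∂μ, inner ℝ n (q - m) ≠ 0 := by
          rw [ae_iff]
          simpa using hμ.hyperplane hn0 m
        filter_upwards [hae] with q hq
        have h1 : Continuous fun z : (E × E) × ℝ => |inner ℝ z.1.1 (q - z.1.2)| := by fun_prop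
        have h2 : Continuous fun z : (E × E) × ℝ => z.2 := by fun_prop
        have h3 : ∀ᶠ z in 𝓝 ((n, m), (0 : ℝ)), z.2 < |inner ℝ z.1.1 (q - z.1.2)| :=
          (isOpen_lt h2 h1).mem_nhds (by simpa using hq)
        refine tendsto_const_nhds.congr' ?_
        filter_upwards [h3] with z hz
        rw [Set.indicator_of_notMem]
        simpa using hz
    rw [integral_zero] at hlim
    filter_upwards [hlim.eventually_lt_const hc] with z hz
    rw [integral_indicator (hmeas z)] at hz
    simpa using hz
  -- Compactness of the set of pairs (normal, base point) makes the local bounds uniform.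
  have h1 := hcpt.eventually_forall_of_forall_eventually
    (x₀ := (0 : ℝ)) (P := fun h x => μ.real {q | |inner ℝ x.1 (q - x.2)| ≤ h} < c) ?_
  · obtain ⟨h, hh, hpos⟩ := ((h1.filter_mono nhdsWithin_le_nhds).and
      (self_mem_nhdsWithin : Set.Ioi (0 : ℝ) ∈ 𝓝[>] 0)).exists
    exact ⟨h, hpos, fun n m hn hm => hh (n, m) ⟨by simpa using hn, hm⟩⟩
  · intro x hx
    exact (continuous_swap.tendsto ((0 : ℝ), x)).eventually (key x hx)

/-- The centroid of a cell with non-negligible mass lies at a definite distance beyond every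
bisector. -/
theorem exists_le_inner_centroid (hk : 0 < k) (hα : 0 < α) (hμ : BisectorsNull μ)
    (hK : IsCompact K) (hconv : Convex ℝ K) (hKμ : ∀ᵐ q ∂μ, q ∈ K) {c : ℝ} (hc : 0 < c) :
    ∃ δ > 0, ∀ P : ι → E, (∀ i, P i ∈ K) → ∀ i, c ≤ μ.real (cell P i) → ∀ j, P i ≠ P j →
      δ * ‖P i - P j‖ ≤
        inner ℝ (P i - P j) (centroid μ k α P i - (2⁻¹ : ℝ) • (P i + P j)) := by
  obtain ⟨h, hh, hslab⟩ := exists_slab_lt hμ hK (half_pos hc)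
  obtain ⟨R, hR⟩ := hK.isBounded.exists_norm_le
  have hw0 : 0 < k * Real.exp (-α * (R + R) ^ 2) := by positivity
  set w0 := k * Real.exp (-α * (R + R) ^ 2)
  have hw : ∀ p ∈ K, ∀ q ∈ K, w0 ≤ weight k α (p - q) := by
    intro p hp q hq
    unfold weight
    have h1 : ‖p - q‖ ≤ R + R := (norm_sub_le _ _).trans (add_le_add (hR p hp) (hR q hq))
    have h2 : ‖p - q‖ ^ 2 ≤ (R + R) ^ 2 := by gcongr
    gcongr k * Real.exp ?_
    nlinarith
  have hB : 0 < k * (μ.real Set.univ + 1) := by positivity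
  -- Outside a slab of half-width `h` the cell keeps measure at least `c / 2`, with weight at least
  -- `w0`; the denominator bounds the mass of the cell, and the `+ 1` keeps it positive.
  refine ⟨w0 * h * (c / 2) / (k * (μ.real Set.univ + 1)), by positivity, ?_⟩
  intro P hP i hi j hij
  have hD : 0 < ‖P i - P j‖ := norm_pos_iff.2 (sub_ne_zero.2 hij)
  set m := (2⁻¹ : ℝ) • (P i + P j) with hm
  have hmK : m ∈ K := by
    rw [hm, smul_add]
    exact hconv (hP i) (hP j) (by norm_num) (by norm_num) (by norm_num)
  set n := ‖P i - P j‖⁻¹ • (P i - P j) with hn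
  have hn1 : ‖n‖ = 1 := by
    rw [hn, norm_smul, norm_inv, norm_norm, inv_mul_cancel₀ hD.ne']
  have hmass := mass_pos hk hα (hc.trans_le hi)
  have hint := mass_mul_centroid_sub hK hKμ hmass.ne' (innerSL ℝ n) (inner ℝ n m)
  set S := {q | |inner ℝ n (q - m)| ≤ h} with hS
  have hSm : MeasurableSet S := (isClosed_le (by fun_prop) (by fun_prop)).measurableSet
  have hnn : ∀ q ∈ cell P i, 0 ≤ inner ℝ n (q - m) := by
    intro q hq
    rw [hn, real_inner_smul_left]
    exact mul_nonneg (by positivity) (inner_midpoint_nonneg hq j)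
  have hwc : Continuous (weight k α : E → ℝ) := continuous_weight k α
  have hfi : Integrable (fun q => weight k α (P i - q) * (innerSL ℝ n q - inner ℝ n m)) μ :=
    integrable_of_continuous_of_compact hK hKμ (by fun_prop)
  have hsub : ∀ q, innerSL ℝ n q - inner ℝ n m = inner ℝ n (q - m) := by
    intro q
    rw [innerSL_apply_apply, inner_sub_right]
  have hset : c / 2 ≤ μ.real (cell P i \ S) := by
    have h1 := hslab n m hn1 hmK
    have h2 := measureReal_sdiff_add_inter (μ := μ) (s := cell P i) hSm
    have h3 : μ.real (cell P i ∩ S) ≤ μ.real S := measureReal_mono Set.inter_subset_right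
    linarith
  have hlow : w0 * h * (c / 2) ≤
      ∫ q in cell P i, weight k α (P i - q) * (innerSL ℝ n q - inner ℝ n m) ∂μ := by
    calc w0 * h * (c / 2) ≤ w0 * h * μ.real (cell P i \ S) := by gcongr
      _ = ∫ _ in cell P i \ S, w0 * h ∂μ := by simp [mul_comm]
      _ ≤ ∫ q in cell P i \ S, weight k α (P i - q) * (innerSL ℝ n q - inner ℝ n m) ∂μ := by
        refine integral_mono_ae (integrable_const _) hfi.integrableOn ?_
        filter_upwards [ae_restrict_of_ae hKμ,
          ae_restrict_mem ((measurableSet_cell P i).diff hSm)] with q hq hqc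
        rw [hsub]
        have h1 : h < |inner ℝ n (q - m)| := not_le.1 hqc.2
        rw [abs_of_nonneg (hnn q hqc.1)] at h1
        exact mul_le_mul (hw _ (hP i) _ hq) h1.le hh.le (weight_pos hk _).le
      _ ≤ _ := by
        refine setIntegral_mono_set hfi.integrableOn ?_ Set.sdiff_subset.eventuallyLE
        filter_upwards [ae_restrict_mem (measurableSet_cell P i)] with q hqc
        rw [hsub]
        exact mul_nonneg (weight_pos hk _).le (hnn q hqc)
  rw [← hint, hsub] at hlow
  have hM : mass μ k α P i ≤ k * (μ.real Set.univ + 1) :=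
    (mass_le hk hα P i).trans (by nlinarith)
  have hnC : 0 ≤ inner ℝ n (centroid μ k α P i - m) := by
    by_contra hneg
    push Not at hneg
    have : 0 < w0 * h * (c / 2) := by positivity
    nlinarith
  have h4 : w0 * h * (c / 2) / (k * (μ.real Set.univ + 1)) ≤
      inner ℝ n (centroid μ k α P i - m) := by
    rw [div_le_iff₀ hB]
    calc _ ≤ _ := hlow
      _ ≤ k * (μ.real Set.univ + 1) * inner ℝ n (centroid μ k α P i - m) := by gcongr
      _ = _ := mul_comm _ _
  have h5 : inner ℝ (P i - P j) (centroid μ k α P i - m) =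
      inner ℝ n (centroid μ k α P i - m) * ‖P i - P j‖ := by
    rw [hn, real_inner_smul_left]
    field_simp
  rw [h5]
  gcongr

/-- Every configuration with collisions has the same range as part of a configuration without. -/
theorem exists_injective_range_subset {X ι : Type*} [Fintype ι] {K : Set X} {P₀ P₁ : ι → X}
    (h₀ : ∀ i, P₀ i ∈ K) (h₁ : ∀ i, P₁ i ∈ K) (hinj : Function.Injective P₁) :
    ∃ P : ι → X, Function.Injective P ∧ (∀ i, P i ∈ K) ∧ ∀ i, ∃ j, P j = P₀ i := by
  classical
  -- Pad the range of `P₀` with values of `P₁` to exactly `Fintype.card ι` points.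
  obtain ⟨u, hu1, hu2, hu3⟩ := Finset.exists_subsuperset_card_eq
    (s := Finset.univ.image P₀) (t := Finset.univ.image P₀ ∪ Finset.univ.image P₁)
    Finset.subset_union_left (n := Fintype.card ι) Finset.card_image_le
    ((Finset.card_image_of_injective _ hinj).symm.le.trans
      (Finset.card_le_card Finset.subset_union_right))
  let e : ι ≃ u := Fintype.equivOfCardEq (by simp [hu3])
  refine ⟨fun i => e i, fun a b h => e.injective (Subtype.ext h), fun i => ?_, fun i => ?_⟩
  · have := hu2 (e i).2
    simp only [Finset.mem_union, Finset.mem_image, Finset.mem_univ, true_and] at this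
    rcases this with ⟨a, ha⟩ | ⟨a, ha⟩
    · show (e i : X) ∈ K
      exact ha ▸ h₀ a
    · show (e i : X) ∈ K
      exact ha ▸ h₁ a
  · have : P₀ i ∈ u := hu1 (by simp)
    exact ⟨e.symm ⟨P₀ i, this⟩, by simp⟩

/-- Near a limit of configurations, each cluster contains a point whose cell has non-negligible
mass. -/
theorem exists_le_measure_cell [Fintype ι] (hμ : BisectorsNull μ)
    (hpos : ∀ P : ι → E, Function.Injective P → (∀ i, P i ∈ K) → ∀ i, 0 < μ.real (cell P i))
    {P₀ P₁ : ι → E} (h₀ : ∀ i, P₀ i ∈ K) (h₁ : ∀ i, P₁ i ∈ K) (hinj : Function.Injective P₁)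
    (i₀ : ι) : ∃ c > 0, ∃ ε > 0, ∀ P : ι → E, (∀ i, ‖P i - P₀ i‖ ≤ ε) →
      ∃ i, P₀ i = P₀ i₀ ∧ c ≤ μ.real (cell P i) := by
  obtain ⟨P', hP', hP'K, hP'r⟩ := exists_injective_range_subset h₀ h₁ hinj
  -- Points closer to the cluster site than to any other site, with margin `1 / (n + 1)`. If all
  -- were null, so would be the cell of that site in the collision-free `P'`.
  let S : ℕ → Set E := fun n =>
    {q | ∀ l, P₀ l ≠ P₀ i₀ → ‖q - P₀ i₀‖ + 1 / ((n : ℝ) + 1) ≤ ‖q - P₀ l‖}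
  have hSpos : ∃ n, μ (S n) ≠ 0 := by
    by_contra hcon
    push Not at hcon
    have h2 : μ (⋃ n, S n) = 0 := measure_iUnion_null hcon
    obtain ⟨a, ha⟩ := hP'r i₀
    have h3 : ∀ᵐ q ∂μ, q ∉ cell P' a := by
      have h4 : ∀ᵐ q ∂μ, q ∉ ⋃ n, S n := measure_eq_zero_iff_ae_notMem.1 h2
      filter_upwards [h4, hμ.ae_ne hP'] with q hq hne hqa
      refine hq (Set.mem_iUnion.2 ?_)
      have h5 : ∀ l, P₀ l ≠ P₀ i₀ → ∀ᶠ n : ℕ in atTop,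
          ‖q - P₀ i₀‖ + 1 / ((n : ℝ) + 1) ≤ ‖q - P₀ l‖ := by
        intro l hl
        obtain ⟨b, hb⟩ := hP'r l
        have hab : a ≠ b := by
          rintro rfl
          exact hl (hb.symm.trans ha)
        have h6 : ‖q - P₀ i₀‖ < ‖q - P₀ l‖ := by
          rw [← ha, ← hb]
          exact lt_of_le_of_ne (hqa b) (hne a b hab)
        have h7 := (tendsto_one_div_add_atTop_nhds_zero_nat (𝕜 := ℝ)).eventually_lt_const
          (sub_pos.2 h6)
        filter_upwards [h7] with n hn
        linarith
      have h8 : ∀ᶠ n : ℕ in atTop, q ∈ S n := by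
        simp only [S, Set.mem_ofPred_eq]
        rw [eventually_all]
        intro l
        by_cases hl : P₀ l = P₀ i₀
        · simp [hl]
        · simpa [hl] using h5 l hl
      exact h8.exists
    have h9 := hpos P' hP' hP'K a
    rw [Measure.real, measure_eq_zero_iff_ae_notMem.2 h3] at h9
    simp at h9
  obtain ⟨n, hn⟩ := hSpos
  have : Nonempty ι := ⟨i₀⟩
  have hn' : 0 < μ.real (S n) := ENNReal.toReal_pos hn (measure_ne_top _ _)
  have hcard : (0 : ℝ) < Fintype.card ι := by exact_mod_cast Fintype.card_pos
  -- Moving two generators costs at most two thirds of the margin, so the cells of the cluster still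
  -- cover `S n`; by pigeonhole one has at least the average share.
  refine ⟨μ.real (S n) / Fintype.card ι, by positivity, 1 / ((n : ℝ) + 1) / 3, by positivity,
    fun P hP => ?_⟩
  by_contra hcon
  push Not at hcon
  classical
  have hcover : S n ⊆ ⋃ i ∈ Finset.univ.filter (fun i => P₀ i = P₀ i₀), cell P i := by
    intro q hq
    obtain ⟨i, hi⟩ := exists_mem_cell P q
    refine Set.mem_biUnion (x := i) ?_ hi
    simp only [Finset.coe_filter, Finset.mem_univ, true_and, Set.mem_ofPred_eq]
    by_contra hne
    have h2 := hq i hne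
    have h3 := hi i₀
    have h4 : ‖q - P i₀‖ ≤ ‖q - P₀ i₀‖ + ‖P i₀ - P₀ i₀‖ := by
      rw [show q - P i₀ = (q - P₀ i₀) - (P i₀ - P₀ i₀) by abel]
      exact norm_sub_le _ _
    have h5 : ‖q - P₀ i‖ ≤ ‖q - P i‖ + ‖P i - P₀ i‖ := by
      rw [show q - P₀ i = (q - P i) + (P i - P₀ i) by abel]
      exact norm_add_le _ _
    have h6 := hP i
    have h7 := hP i₀
    have h8 : 0 < 1 / ((n : ℝ) + 1) := by positivity
    linarith
  have h2 : μ.real (S n) ≤ ∑ i ∈ Finset.univ.filter (fun i => P₀ i = P₀ i₀), μ.real (cell P i) :=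
    (measureReal_mono hcover (measure_ne_top _ _)).trans (measureReal_biUnion_finset_le _ _)
  have hne : (Finset.univ.filter (fun i => P₀ i = P₀ i₀)).Nonempty := ⟨i₀, by simp⟩
  have h3 := Finset.sum_lt_sum_of_nonempty hne fun i hi => hcon i (by simpa using hi)
  rw [Finset.sum_const, nsmul_eq_mul] at h3
  have h4 : ((Finset.univ.filter (fun i => P₀ i = P₀ i₀)).card : ℝ) ≤ Fintype.card ι := by
    exact_mod_cast Finset.card_le_univ _
  have h5 : ((Finset.univ.filter (fun i => P₀ i = P₀ i₀)).card : ℝ) *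
      (μ.real (S n) / Fintype.card ι) ≤ Fintype.card ι * (μ.real (S n) / Fintype.card ι) := by
    gcongr
  rw [mul_div_cancel₀ _ hcard.ne'] at h5
  linarith

end Estimates

/-! ### Differential inequalities on the half-line -/

section RealLemmas

theorem mul_sub_le_of_hasDerivWithinAt {f f' : ℝ → ℝ} {a b c : ℝ} (ha : 0 ≤ a) (hab : a ≤ b)
    (hf : ∀ t ∈ Set.Icc a b, HasDerivWithinAt f (f' t) (Set.Ici 0) t)
    (hc : ∀ t ∈ Set.Icc a b, c ≤ f' t) : c * (b - a) ≤ f b - f a := by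
  have hsub : Set.Icc a b ⊆ Set.Ici 0 := fun t ht => ha.trans ht.1
  have hd : ∀ t ∈ interior (Set.Icc a b), HasDerivAt f (f' t) t := by
    intro t ht
    rw [interior_Icc] at ht
    exact (hf t ⟨ht.1.le, ht.2.le⟩).hasDerivAt (Ici_mem_nhds (ha.trans_lt ht.1))
  refine (convex_Icc a b).mul_sub_le_image_sub_of_le_deriv
    (fun t ht => ((hf t ht).mono hsub).continuousWithinAt)
    (fun t ht => (hd t ht).differentiableAt.differentiableWithinAt) (fun t ht => ?_)
    a ⟨le_rfl, hab⟩ b ⟨hab, le_rfl⟩ hab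
  rw [(hd t ht).deriv]
  exact hc t (interior_subset ht)

/-- A function that does not increase above a level stays below this level. -/
theorem le_of_deriv_nonpos_above {f f' : ℝ → ℝ} {a b c : ℝ} (ha : 0 ≤ a)
    (hf : ∀ t ∈ Set.Icc a b, HasDerivWithinAt f (f' t) (Set.Ici 0) t) (hfa : f a ≤ c)
    (hc : ∀ t ∈ Set.Icc a b, c < f t → f' t ≤ 0) : ∀ t ∈ Set.Icc a b, f t ≤ c := by
  have hsub : Set.Icc a b ⊆ Set.Ici 0 := fun t ht => ha.trans ht.1
  intro t ht
  -- A barrier of slope `ε`, starting strictly above `c`, makes the comparison strict; then `ε`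
  -- tends to zero.
  have h1 : ∀ ε > 0, f t ≤ c + ε * (1 + (t - a)) := by
    intro ε hε
    refine image_le_of_deriv_right_lt_deriv_boundary (f := f) (f' := f') (a := a) (b := b)
      (B := fun t => c + ε * (1 + (t - a))) (B' := fun _ => ε)
      (fun t ht => ((hf t ht).mono hsub).continuousWithinAt)
      (fun t ht => (hf t ⟨ht.1, ht.2.le⟩).mono (Set.Ici_subset_Ici.2 (ha.trans ht.1))) ?_ ?_ ?_ ht
    · simp only [sub_self, add_zero, mul_one]
      linarith
    · intro x
      simpa using ((((hasDerivAt_id x).sub_const a).const_add 1).const_mul ε).const_add c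
    · intro x hx hxe
      refine (hc x ⟨hx.1, hx.2.le⟩ ?_).trans_lt hε
      rw [hxe]
      have : 0 < ε * (1 + (x - a)) := mul_pos hε (by linarith [hx.1])
      linarith
  have h2 : 0 < 1 + (t - a) := by linarith [ht.1]
  refine le_of_forall_pos_le_add fun ε hε => ?_
  have := h1 (ε / (1 + (t - a))) (by positivity)
  rwa [div_mul_cancel₀ _ h2.ne'] at this

/-- A functional that grows along a Lipschitz curve near a limit point of the curve
has grown by a definite amount whenever the curve is close to the limit point. -/
theorem exists_mul_le_sub_of_tendsto {X : Type*} [PseudoMetricSpace X] {x : ℝ → X} {x₀ : X}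
    {L : ℝ} (hL : 0 ≤ L) (hx : ∀ s t, 0 ≤ s → 0 ≤ t → dist (x s) (x t) ≤ L * |s - t|) {t : ℕ → ℝ}
    (ht : Tendsto t atTop atTop) (hxt : Tendsto (fun n => x (t n)) atTop (𝓝 x₀))
    {f f' : ℝ → ℝ} (hf : ∀ s, 0 ≤ s → HasDerivWithinAt f (f' s) (Set.Ici 0) s) {r c : ℝ}
    (hr : 0 < r) (hc : ∀ s, 0 ≤ s → dist (x s) x₀ ≤ r → c ≤ f' s) :
    ∃ τ > 0, ∀ᶠ n in atTop, τ ≤ t n ∧ c * τ ≤ f (t n) - f (t n - τ) := by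
  -- In time `τ` the curve moves by at most `r / 2`, so it stays in the `r`-ball throughout `[t n -
  -- τ, t n]`; the `+ 1` covers `L = 0`.
  refine ⟨r / 2 / (L + 1), by positivity, ?_⟩
  set τ := r / 2 / (L + 1) with hτ
  have hτ0 : 0 < τ := by positivity
  have hLτ : L * τ ≤ r / 2 := by
    rw [hτ, mul_div_assoc', div_le_iff₀ (by positivity)]
    nlinarith
  have h1 : ∀ᶠ n in atTop, dist (x (t n)) x₀ < r / 2 :=
    (tendsto_iff_dist_tendsto_zero.1 hxt).eventually_lt_const (half_pos hr)
  filter_upwards [h1, ht.eventually_ge_atTop τ] with n hn hn'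
  refine ⟨hn', ?_⟩
  have h2 := mul_sub_le_of_hasDerivWithinAt (f := f) (f' := f') (c := c) (a := t n - τ)
    (b := t n) (by linarith) (by linarith) (fun s hs => hf s (by linarith [hs.1])) ?_
  · simpa using h2
  · intro s hs
    have hs0 : 0 ≤ s := by linarith [hs.1]
    refine hc s hs0 ?_
    have h3 := hx s (t n) hs0 (by linarith)
    have h4 : |s - t n| ≤ τ := by
      rw [abs_le]
      constructor <;> linarith [hs.1, hs.2]
    have h5 : L * |s - t n| ≤ L * τ := by gcongr
    linarith [dist_triangle (x s) (x (t n)) x₀]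

end RealLemmas

/-! ### Invariance of collision-free configurations -/

section Flow

variable {E : Type*} [NormedAddCommGroup E] [InnerProductSpace ℝ E] {ι : Type*}
  [MeasurableSpace E]

/-- A trajectory that moves each point towards the centroid of its cell, with gains `s` between
`0` and `κ`, speeds at most `U`, and gains bounded below as long as the centroids are at a
bounded distance. -/
structure IsCentroidFlow (μ : Measure E) (k α κ : ℝ) (U : ι → ℝ) (P : ℝ → ι → E)
    (s : ℝ → ι → ℝ) : Prop where
  hasDeriv : ∀ t, 0 ≤ t → ∀ i, HasDerivWithinAt (fun τ => P τ i)
    (s t i • (centroid μ k α (P t) i - P t i)) (Set.Ici 0) t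
  nonneg : ∀ t i, 0 ≤ s t i
  le : ∀ t i, s t i ≤ κ
  speed : ∀ t i, ‖s t i • (centroid μ k α (P t) i - P t i)‖ ≤ U i
  lower : ∀ t i D, 0 < D → ‖centroid μ k α (P t) i - P t i‖ ≤ D → min κ (U i / D) ≤ s t i

/-- The standing assumptions on the density and the domain. -/
structure IsAdmissible (ι : Type*) (μ : Measure E) (K : Set E) : Prop where
  compact : IsCompact K
  convex : Convex ℝ K
  ae_mem : ∀ᵐ q ∂μ, q ∈ K
  bisectors : BisectorsNull μ
  cell_pos : ∀ P : ι → E, Function.Injective P → (∀ i, P i ∈ K) → ∀ i, 0 < μ.real (cell P i)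

variable [BorelSpace E] [FiniteDimensional ℝ E] [Fintype ι]
  {μ : Measure E} [IsFiniteMeasure μ] {K : Set E} {k α κ : ℝ} {U : ι → ℝ} {P : ℝ → ι → E}
  {s : ℝ → ι → ℝ}

/-- Splits the velocity at the midpoint: the first term is nonnegative for a centroid, the second is
the only attraction. -/
theorem inner_velocity (p p' c : E) (r : ℝ) :
    inner ℝ (p - p') (r • (c - p)) =
      r * inner ℝ (p - p') (c - (2⁻¹ : ℝ) • (p + p')) - r / 2 * ‖p - p'‖ ^ 2 := by
  have h : c - p = (c - (2⁻¹ : ℝ) • (p + p')) - (2⁻¹ : ℝ) • (p - p') := by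
    module
  rw [inner_smul_right, h, inner_sub_right, inner_smul_right, real_inner_self_eq_norm_sq]
  ring

/-- The distance of two points decays at most exponentially. -/
theorem neg_le_inner_velocity_sub (hA : IsAdmissible ι μ K) (hk : 0 < k) {κ : ℝ} {Q : ι → E}
    {i j : ι} (hj : 0 < mass μ k α Q j) {a b : ℝ}
    (hb : 0 ≤ b) (haκ : a ≤ κ) (hbκ : b ≤ κ) :
    a * inner ℝ (Q i - Q j) (centroid μ k α Q i - (2⁻¹ : ℝ) • (Q i + Q j)) - κ * ‖Q i - Q j‖ ^ 2 ≤
      inner ℝ (Q i - Q j)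
      (a • (centroid μ k α Q i - Q i) - b • (centroid μ k α Q j - Q j)) := by
  have h2 := inner_centroid_nonneg hA.compact hA.ae_mem hk hj i
  have h3 : inner ℝ (Q i - Q j) (b • (centroid μ k α Q j - Q j)) =
      -inner ℝ (Q j - Q i) (b • (centroid μ k α Q j - Q j)) := by
    rw [← inner_neg_left, neg_sub]
  rw [inner_sub_right (Q i - Q j) (a • _), h3, inner_velocity, inner_velocity, norm_sub_rev (Q j)]
  have h4 : a * ‖Q i - Q j‖ ^ 2 ≤ κ * ‖Q i - Q j‖ ^ 2 := by gcongr
  have h5 : b * ‖Q i - Q j‖ ^ 2 ≤ κ * ‖Q i - Q j‖ ^ 2 := by gcongr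
  have h6 := mul_nonneg hb h2
  linarith

theorem eventually_injective {X : Type*} [TopologicalSpace X] [T2Space X] {Q : ι → X}
    (hQ : Function.Injective Q) : ∀ᶠ Q' in 𝓝 Q, Function.Injective Q' := by
  have : ∀ᶠ Q' in 𝓝 Q, ∀ i j, i ≠ j → Q' i ≠ Q' j := by
    rw [eventually_all]; intro i
    rw [eventually_all]; intro j
    by_cases h : i = j
    · simp [h]
    · have h1 : Continuous fun Q' : ι → X => Q' i := continuous_apply i
      have h2 : Continuous fun Q' : ι → X => Q' j := continuous_apply j
      filter_upwards [(isOpen_ne_fun h1 h2).mem_nhds (hQ.ne h)] with Q' hQ' _ using hQ'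
  filter_upwards [this] with Q' hQ' i j hij
  by_contra h
  exact hQ' i j h hij

namespace IsCentroidFlow

variable (hF : IsCentroidFlow μ k α κ U P s)
include hF

theorem hasDeriv_pi {t : ℝ} (ht : 0 ≤ t) : HasDerivWithinAt P
    (fun i => s t i • (centroid μ k α (P t) i - P t i)) (Set.Ici 0) t :=
  hasDerivWithinAt_pi.2 (hF.hasDeriv t ht)

theorem lipschitz {a b : ℝ} (ha : 0 ≤ a) (hb : 0 ≤ b) :
    dist (P a) (P b) ≤ (∑ i, U i) * |a - b| := by
  have hU : ∀ i, 0 ≤ U i := fun i => (norm_nonneg _).trans (hF.speed 0 i)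
  rw [dist_pi_le_iff (mul_nonneg (Finset.sum_nonneg fun i _ => hU i) (abs_nonneg _))]
  intro i
  have h := (convex_Ici (0 : ℝ)).norm_image_sub_le_of_norm_hasDerivWithin_le
    (fun t ht => hF.hasDeriv t ht i) (fun t _ => hF.speed t i) hb ha
  rw [dist_eq_norm]
  refine h.trans ?_
  rw [Real.norm_eq_abs]
  gcongr
  exact Finset.single_le_sum (fun i _ => hU i) (Finset.mem_univ i)

variable (hA : IsAdmissible ι μ K) (hk : 0 < k)
include hA hk

/-- Configurations stay in the domain as long as the cells have positive masses. -/
theorem mem_of_mass_pos {a b : ℝ} (ha : 0 ≤ a) (hPa : ∀ i, P a i ∈ K)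
    (hm : ∀ t ∈ Set.Icc a b, ∀ i, 0 < mass μ k α (P t) i) :
    ∀ t ∈ Set.Icc a b, ∀ i, P t i ∈ K := by
  intro t ht i
  by_contra hc
  -- A functional separating an escaped point from `K` cannot grow above the level `u`, since the
  -- centroid lies below it.
  obtain ⟨f, u, hf, hu⟩ := geometric_hahn_banach_closed_point hA.convex hA.compact.isClosed hc
  refine absurd (le_of_deriv_nonpos_above (f := fun τ => f (P τ i))
    (f' := fun τ => f (s τ i • (centroid μ k α (P τ) i - P τ i))) ha (fun τ hτ => ?_)
    (hf _ (hPa i)).le (fun τ hτ hlt => ?_) t ht) (not_le.2 hu)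
  · exact f.hasFDerivAt.comp_hasDerivWithinAt τ (hF.hasDeriv τ (ha.trans hτ.1) i)
  · have h1 := hf _ (centroid_mem hA.compact hA.ae_mem hA.convex hk (hm τ hτ i))
    rw [map_smul, map_sub, smul_eq_mul]
    exact mul_nonpos_of_nonneg_of_nonpos (hF.nonneg τ i) (by linarith)

theorem exp_mul_norm_sq_le {a b : ℝ} (ha : 0 ≤ a) (hab : a ≤ b)
    (hm : ∀ t ∈ Set.Icc a b, ∀ i, 0 < mass μ k α (P t) i) (i j : ι) :
    Real.exp (2 * κ * a) * ‖P a i - P a j‖ ^ 2 ≤ Real.exp (2 * κ * b) * ‖P b i - P b j‖ ^ 2 := by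
  have h := mul_sub_le_of_hasDerivWithinAt (c := 0)
    (f := fun t => Real.exp (2 * κ * t) * ‖P t i - P t j‖ ^ 2) (f' := fun t =>
      Real.exp (2 * κ * t) * (2 * κ) * ‖P t i - P t j‖ ^ 2 + Real.exp (2 * κ * t) *
        (2 * inner ℝ (P t i - P t j) (s t i • (centroid μ k α (P t) i - P t i) -
          s t j • (centroid μ k α (P t) j - P t j)))) ha hab ?_ ?_
  · linarith
  · intro t ht
    have h1 : HasDerivWithinAt (fun t => Real.exp (2 * κ * t)) (Real.exp (2 * κ * t) * (2 * κ))
        (Set.Ici 0) t := by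
      simpa using (((hasDerivAt_id t).const_mul (2 * κ)).exp).hasDerivWithinAt
    exact h1.mul ((hF.hasDeriv t (ha.trans ht.1) i).sub (hF.hasDeriv t (ha.trans ht.1) j)).norm_sq
  · intro t ht
    have h1 := neg_le_inner_velocity_sub hA hk (i := i) (hm t ht j)
      (hF.nonneg t j) (hF.le t i) (hF.le t j)
    have h2 := mul_nonneg (hF.nonneg t i)
      (inner_centroid_nonneg hA.compact hA.ae_mem hk (hm t ht i) j)
    have h3 := Real.exp_pos (2 * κ * t)
    rw [mul_assoc, ← mul_add]
    refine mul_nonneg h3.le ?_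
    linarith

variable (hα : 0 < α)
include hα

/-- Configurations stay configurations for a short time. -/
theorem exists_forall_mem {a : ℝ} (ha : 0 ≤ a) (hPa : ∀ i, P a i ∈ K)
    (hinj : Function.Injective (P a)) : ∃ δ > 0, ∀ t ∈ Set.Icc a (a + δ),
      (∀ i, P t i ∈ K) ∧ ∀ i, 0 < mass μ k α (P t) i := by
  have h1 : ∀ᶠ Q in 𝓝 (P a), ∀ i, 0 < mass μ k α Q i := by
    rw [eventually_all]
    intro i
    exact (continuousAt_mass hA.compact hA.ae_mem hA.bisectors hinj i).eventually_const_lt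
      (mass_pos hk hα (hA.cell_pos _ hinj hPa i))
  have h2 : ∀ᶠ t in 𝓝[≥] a, ∀ i, 0 < mass μ k α (P t) i :=
    (((hF.hasDeriv_pi ha).continuousWithinAt).mono (Set.Ici_subset_Ici.2 ha)).eventually h1
  obtain ⟨b, hab, hb⟩ := mem_nhdsGE_iff_exists_Icc_subset.1 h2
  refine ⟨b - a, sub_pos.2 hab, fun t ht => ?_⟩
  rw [add_sub_cancel] at ht
  exact ⟨hF.mem_of_mass_pos hA hk ha hPa (fun t ht => hb ht) t ht, hb ht⟩

/-- Trajectories that start at configurations consist of configurations. -/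
theorem mem_configurations (hP0 : ∀ i, P 0 i ∈ K) (hinj : Function.Injective (P 0)) {t : ℝ}
    (ht : 0 ≤ t) : (∀ i, P t i ∈ K) ∧ Function.Injective (P t) := by
  -- Injectivity is not a closed condition; the exponential lower bound on distances is, which
  -- permits continuous induction on `[0, t]`.
  let T : Set (ℝ × (ι → E)) := {z | (∀ i, z.2 i ∈ K) ∧ ∀ i j,
    ‖P 0 i - P 0 j‖ ^ 2 ≤ Real.exp (2 * κ * z.1) * ‖z.2 i - z.2 j‖ ^ 2}
  have hT : IsClosed T := by
    refine IsClosed.and ?_ ?_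
    · simp only [Set.ofPred_forall]
      exact isClosed_iInter fun i => hA.compact.isClosed.preimage (by fun_prop)
    · simp only [Set.ofPred_forall]
      exact isClosed_iInter fun i => isClosed_iInter fun j =>
        isClosed_le (by fun_prop) (by fun_prop)
  have hTinj : ∀ τ, (τ, P τ) ∈ T → Function.Injective (P τ) := by
    intro τ hτ i j hij
    by_contra hne
    have h1 := hτ.2 i j
    simp only [hij, sub_self, norm_zero] at h1
    have h2 : 0 < ‖P 0 i - P 0 j‖ := norm_pos_iff.2 (sub_ne_zero.2 (hinj.ne hne))
    nlinarith
  have hcont : ContinuousOn (fun τ => (τ, P τ)) (Set.Icc 0 t) := fun τ hτ =>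
    continuousWithinAt_id.prodMk
      ((hF.hasDeriv_pi hτ.1).continuousWithinAt.mono Set.Icc_subset_Ici_self)
  have hsub : Set.Icc 0 t ⊆ {τ | (τ, P τ) ∈ T} := by
    refine IsClosed.Icc_subset_of_forall_exists_gt ?_ ?_ ?_
    · rw [Set.inter_comm]
      exact hcont.preimage_isClosed_of_isClosed isClosed_Icc hT
    · exact ⟨hP0, fun i j => by simp⟩
    · rintro x ⟨hx, hx0, -⟩ y hxy
      obtain ⟨δ, hδ, h⟩ := hF.exists_forall_mem hA hk hα hx0 hx.1 (hTinj x hx)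
      have hxy' : x < min y (x + δ) := lt_min hxy (by linarith)
      refine ⟨min y (x + δ), ⟨(h _ ⟨hxy'.le, min_le_right _ _⟩).1, fun i j => ?_⟩, hxy',
        min_le_left _ _⟩
      exact (hx.2 i j).trans (hF.exp_mul_norm_sq_le hA hk hx0 hxy'.le
        (fun τ hτ => (h τ ⟨hτ.1, hτ.2.trans (min_le_right _ _)⟩).2) i j)
  have := hsub ⟨ht, le_rfl⟩
  exact ⟨this.1, hTinj t this⟩

end IsCentroidFlow
end Flow

/-! ### Limit points and convergence -/

section Convergence

variable {E : Type*} [NormedAddCommGroup E] [InnerProductSpace ℝ E] {ι : Type*}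
  [MeasurableSpace E] [BorelSpace E] [FiniteDimensional ℝ E] [Fintype ι]
  {μ : Measure E} [IsFiniteMeasure μ] {K : Set E} {k α κ : ℝ} {U : ι → ℝ} {P : ℝ → ι → E}
  {s : ℝ → ι → ℝ}

theorem hasDerivWithinAt_norm {f : ℝ → E} {f' : E} {S : Set ℝ} {t : ℝ}
    (hf : HasDerivWithinAt f f' S t) (h0 : f t ≠ 0) :
    HasDerivWithinAt (fun τ => ‖f τ‖) (inner ℝ (f t) f' / ‖f t‖) S t := by
  have h1 := hf.norm_sq.sqrt (by simpa using h0)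
  simp only [Real.sqrt_sq (norm_nonneg _)] at h1
  convert h1 using 1
  rw [mul_div_mul_left _ _ two_ne_zero]

namespace IsCentroidFlow

variable (hF : IsCentroidFlow μ k α κ U P s) (hA : IsAdmissible ι μ K) (hk : 0 < k) (hα : 0 < α)
  (hP0 : ∀ i, P 0 i ∈ K) (hinj : Function.Injective (P 0))
include hF hA hk hα hP0 hinj

theorem mass_pos {t : ℝ} (ht : 0 ≤ t) (i : ι) : 0 < mass μ k α (P t) i :=
  have h := hF.mem_configurations hA hk hα hP0 hinj ht
  MultiRobotSearch.mass_pos hk hα (hA.cell_pos _ h.2 h.1 i)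

/-- Points and centroids stay in the bounded set `K`, so saturation reduces the gain only by a
bounded factor. -/
theorem exists_le_gain (hκ : 0 < κ) (hU : ∀ i, 0 < U i) :
    ∃ σ > 0, ∀ t, 0 ≤ t → ∀ i, σ ≤ s t i := by
  obtain ⟨R, hR0, hR⟩ := hA.compact.isBounded.exists_pos_norm_le
  rcases isEmpty_or_nonempty ι with hι | hι
  · exact ⟨1, one_pos, fun t _ i => isEmptyElim i⟩
  obtain ⟨j, hj⟩ := Finite.exists_min fun i => min κ (U i / (R + R))
  refine ⟨min κ (U j / (R + R)), lt_min hκ (div_pos (hU j) (by positivity)), fun t ht i => ?_⟩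
  refine (hj i).trans (hF.lower t i (R + R) (by positivity) ((norm_sub_le _ _).trans ?_))
  have h1 := hF.mem_configurations hA hk hα hP0 hinj ht
  exact add_le_add (hR _ (centroid_mem hA.compact hA.ae_mem hA.convex hk
    (hF.mass_pos hA hk hα hP0 hinj ht i))) (hR _ (h1.1 i))

/-- Limit points of trajectories are free of collisions. -/
theorem injective_of_tendsto (hκ : 0 < κ) (hU : ∀ i, 0 < U i) {t : ℕ → ℝ}
    (ht : Tendsto t atTop atTop) {Q : ι → E} (hQ : Tendsto (fun n => P (t n)) atTop (𝓝 Q)) :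
    Function.Injective Q := by
  classical
  by_contra hcon
  simp only [Function.Injective, not_forall] at hcon
  obtain ⟨a, b, hab, hne⟩ := hcon
  have hconf := fun {t : ℝ} (ht : 0 ≤ t) => hF.mem_configurations hA hk hα hP0 hinj ht
  have hmass := fun {t : ℝ} (ht : 0 ≤ t) i => hF.mass_pos hA hk hα hP0 hinj (t := t) ht i
  have hQK : ∀ i, Q i ∈ K := fun i => by
    refine hA.compact.isClosed.mem_of_tendsto (tendsto_pi_nhds.1 hQ i) ?_
    filter_upwards [ht.eventually_ge_atTop 0] with n hn using (hconf hn).1 i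
  obtain ⟨σ, hσ, hs⟩ := hF.exists_le_gain hA hk hα hP0 hinj hκ hU
  obtain ⟨c, hc, ε, hε, hcell⟩ :=
    exists_le_measure_cell hA.bisectors hA.cell_pos hQK hP0 hinj a
  obtain ⟨δ, hδ, hpush⟩ := exists_le_inner_centroid (ι := ι) hk hα hA.bisectors hA.compact
    hA.convex hA.ae_mem hc
  -- Which cell of the cluster is heavy may vary with time, so the distances of all ordered pairs
  -- are summed.
  let T : Finset (ι × ι) := Finset.univ.filter fun z => z.1 ≠ z.2 ∧ Q z.1 = Q a ∧ Q z.2 = Q a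
  let Z : ℝ → ℝ := fun τ => ∑ z ∈ T, ‖P τ z.1 - P τ z.2‖
  let v : ℝ → ι → E := fun τ i => s τ i • (centroid μ k α (P τ) i - P τ i)
  let Z' : ℝ → ℝ := fun τ => ∑ z ∈ T,
    inner ℝ (P τ z.1 - P τ z.2) (v τ z.1 - v τ z.2) / ‖P τ z.1 - P τ z.2‖
  have hpos : ∀ τ, 0 ≤ τ → ∀ z ∈ T, 0 < ‖P τ z.1 - P τ z.2‖ := by
    intro τ hτ z hz
    have h1 : z.1 ≠ z.2 := (Finset.mem_filter.1 hz).2.1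
    exact norm_pos_iff.2 (sub_ne_zero.2 ((hconf hτ).2.ne h1))
  have hZ : ∀ τ, 0 ≤ τ → HasDerivWithinAt Z (Z' τ) (Set.Ici 0) τ := by
    intro τ hτ
    refine HasDerivWithinAt.fun_sum fun z hz => ?_
    exact hasDerivWithinAt_norm ((hF.hasDeriv τ hτ z.1).sub (hF.hasDeriv τ hτ z.2))
      (norm_pos_iff.1 (hpos τ hτ z hz))
  -- Within this radius the attraction over all pairs, at most `T.card * κ * 2 * r`, uses up at most
  -- half of the repulsion `σ * δ` from the heavy cell.
  have hr : 0 < min ε (σ * δ / (4 * κ * (T.card + 1))) := lt_min hε (by positivity)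
  set r := min ε (σ * δ / (4 * κ * (T.card + 1))) with hrdef
  have hgrow : ∀ τ, 0 ≤ τ → dist (P τ) Q ≤ r → σ * δ / 2 ≤ Z' τ := by
    intro τ hτ hd
    have hdi : ∀ i, ‖P τ i - Q i‖ ≤ r := fun i => by
      rw [← dist_eq_norm]
      exact (dist_le_pi_dist _ _ i).trans hd
    obtain ⟨i, hiQ, hi⟩ := hcell (P τ) fun i => (hdi i).trans (min_le_left _ _)
    obtain ⟨j, hjQ, hij⟩ : ∃ j, Q j = Q a ∧ i ≠ j := by
      by_cases hia : i = a
      · exact ⟨b, hab.symm, hia ▸ hne⟩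
      · exact ⟨a, rfl, hia⟩
    have hzT : (i, j) ∈ T := by simp [T, hij, hiQ, hjQ]
    have hterm : ∀ z ∈ T, (if z = (i, j) then σ * δ else 0) - κ * ‖P τ z.1 - P τ z.2‖ ≤
        inner ℝ (P τ z.1 - P τ z.2) (v τ z.1 - v τ z.2) / ‖P τ z.1 - P τ z.2‖ := by
      intro z hz
      have h0 := hpos τ hτ z hz
      rw [le_div_iff₀ h0]
      refine le_trans ?_ (neg_le_inner_velocity_sub hA hk (hmass hτ z.2)
        (hF.nonneg τ z.2) (hF.le τ z.1) (hF.le τ z.2))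
      have h1 : (if z = (i, j) then σ * δ else 0) * ‖P τ z.1 - P τ z.2‖ ≤
          s τ z.1 * inner ℝ (P τ z.1 - P τ z.2)
            (centroid μ k α (P τ) z.1 - (2⁻¹ : ℝ) • (P τ z.1 + P τ z.2)) := by
        split_ifs with hzz
        · have h2 := hpush (P τ) (hconf hτ).1 i hi j ((hconf hτ).2.ne hij)
          rw [hzz]
          rw [mul_assoc]
          exact mul_le_mul (hs τ hτ i) h2 (by positivity) (hF.nonneg τ i)
        · rw [zero_mul]
          exact mul_nonneg (hF.nonneg τ _)
            (inner_centroid_nonneg hA.compact hA.ae_mem hk (hmass hτ _) _)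
      rw [sub_mul, mul_assoc κ, ← sq]
      linarith
    have hsum := Finset.sum_le_sum hterm
    rw [Finset.sum_sub_distrib, Finset.sum_ite_eq' T (i, j) fun _ => σ * δ, if_pos hzT] at hsum
    have hsmall : ∑ z ∈ T, κ * ‖P τ z.1 - P τ z.2‖ ≤ σ * δ / 2 := by
      have h1 : ∀ z ∈ T, κ * ‖P τ z.1 - P τ z.2‖ ≤ κ * (r + r) := by
        intro z hz
        obtain ⟨-, -, hz1, hz2⟩ := Finset.mem_filter.1 hz
        have h2 : P τ z.1 - P τ z.2 = (P τ z.1 - Q z.1) - (P τ z.2 - Q z.2) := by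
          rw [hz1, hz2]; abel
        rw [h2]
        have := (norm_sub_le (P τ z.1 - Q z.1) (P τ z.2 - Q z.2)).trans
          (add_le_add (hdi z.1) (hdi z.2))
        gcongr
      have h3 := Finset.sum_le_sum h1
      rw [Finset.sum_const, nsmul_eq_mul] at h3
      refine h3.trans ?_
      have h4 : r ≤ σ * δ / (4 * κ * (T.card + 1)) := min_le_right _ _
      rw [le_div_iff₀ (by positivity)] at h4
      have h5 : 0 < κ * r := by positivity
      nlinarith
    show σ * δ / 2 ≤ ∑ z ∈ T, _
    linarith
  obtain ⟨τ, hτ, hev⟩ := exists_mul_le_sub_of_tendsto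
    (Finset.sum_nonneg fun i _ => (hU i).le) (fun a b ha hb => hF.lipschitz ha hb) ht hQ hZ hr
    hgrow
  have hlim : Tendsto (fun n => Z (t n)) atTop (𝓝 0) := by
    have h1 : Tendsto (fun n => Z (t n)) atTop (𝓝 (∑ z ∈ T, ‖Q z.1 - Q z.2‖)) :=
      tendsto_finsetSum _ fun z _ =>
        ((tendsto_pi_nhds.1 hQ z.1).sub (tendsto_pi_nhds.1 hQ z.2)).norm
    have h2 : ∑ z ∈ T, ‖Q z.1 - Q z.2‖ = 0 := by
      refine Finset.sum_eq_zero fun z hz => ?_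
      obtain ⟨-, -, hz1, hz2⟩ := Finset.mem_filter.1 hz
      rw [hz1, hz2, sub_self, norm_zero]
    rwa [h2] at h1
  have hcτ : 0 < σ * δ / 2 * τ := by positivity
  obtain ⟨n, ⟨-, hn1⟩, hn2⟩ := (hev.and (hlim.eventually_lt_const hcτ)).exists
  have hn3 : 0 ≤ Z (t n - τ) := Finset.sum_nonneg fun z _ => norm_nonneg _
  linarith

/-- The derivative of the coverage functional along a trajectory. -/
theorem hasDerivWithinAt_coverage {t : ℝ} (ht : 0 ≤ t) :
    HasDerivWithinAt (fun τ => coverage μ k α (P τ))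
      (∑ i, 2 * α * (s t i * (‖moment μ k α (P t) i‖ ^ 2 / mass μ k α (P t) i)))
      (Set.Ici 0) t := by
  have h1 := (hasFDerivAt_coverage hk hα hA.compact hA.ae_mem hA.bisectors
    (hF.mem_configurations hA hk hα hP0 hinj ht).2).comp_hasDerivWithinAt t (hF.hasDeriv_pi ht)
  refine h1.congr_deriv ?_
  rw [sum_apply]
  refine Finset.sum_congr rfl fun i _ => ?_
  have hm := hF.mass_pos hA hk hα hP0 hinj ht i
  have h2 := moment_eq (k := k) (α := α) hA.compact hA.ae_mem hm.ne'
  have h3 : centroid μ k α (P t) i - P t i =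
      (mass μ k α (P t) i)⁻¹ • moment μ k α (P t) i := by
    rw [h2, inv_smul_smul₀ hm.ne']
  simp only [ContinuousLinearMap.comp_apply, ContinuousLinearMap.proj_apply, smul_apply,
    innerSL_apply_apply, smul_eq_mul]
  rw [h3, inner_smul_right, inner_smul_right, real_inner_self_eq_norm_sq]
  ring

/-- Limit points of trajectories are stationary. -/
theorem moment_eq_zero_of_tendsto (hκ : 0 < κ) (hU : ∀ i, 0 < U i) {t : ℕ → ℝ}
    (ht : Tendsto t atTop atTop) {Q : ι → E} (hQ : Tendsto (fun n => P (t n)) atTop (𝓝 Q))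
    (i : ι) : moment μ k α Q i = 0 := by
  by_contra hne
  have hQinj := hF.injective_of_tendsto hA hk hα hP0 hinj hκ hU ht hQ
  have hmass := fun {t : ℝ} (ht : 0 ≤ t) i => hF.mass_pos hA hk hα hP0 hinj (t := t) ht i
  obtain ⟨σ, hσ, hs⟩ := hF.exists_le_gain hA hk hα hP0 hinj hκ hU
  set g := ‖moment μ k α Q i‖ / 2 with hg
  have hg0 : 0 < g := half_pos (norm_pos_iff.2 hne)
  have hB : 0 < k * (μ.real Set.univ + 1) := by positivity
  have hnear : ∀ᶠ Q' in 𝓝 Q, g < ‖moment μ k α Q' i‖ :=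
    (continuousAt_moment hA.compact hA.ae_mem hA.bisectors hQinj i).norm.eventually_const_lt
      (half_lt_self (norm_pos_iff.2 hne))
  obtain ⟨r, hr, hball⟩ := Metric.nhds_basis_closedBall.eventually_iff.1 hnear
  have hterm : ∀ τ, 0 ≤ τ → ∀ j,
      0 ≤ 2 * α * (s τ j * (‖moment μ k α (P τ) j‖ ^ 2 / mass μ k α (P τ) j)) := by
    intro τ hτ j
    have h1 := hF.nonneg τ j
    have h2 := hmass hτ j
    positivity
  set c := 2 * α * (σ * (g ^ 2 / (k * (μ.real Set.univ + 1)))) with hc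
  have hc0 : 0 < c := by positivity
  have hderiv := fun τ (hτ : 0 ≤ τ) =>
    hF.hasDerivWithinAt_coverage hA hk hα hP0 hinj (t := τ) hτ
  obtain ⟨τ, hτ, hev⟩ := exists_mul_le_sub_of_tendsto (c := c)
    (Finset.sum_nonneg fun i _ => (hU i).le) (fun a b ha hb => hF.lipschitz ha hb) ht hQ
    hderiv hr fun τ hτ hd => by
      refine le_trans ?_ (Finset.single_le_sum (fun j _ => hterm τ hτ j) (Finset.mem_univ i))
      have h1 : mass μ k α (P τ) i ≤ k * (μ.real Set.univ + 1) :=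
        (mass_le hk hα (P τ) i).trans (by nlinarith)
      have h2 := hball hd
      have h3 := hmass hτ i
      have h4 := hs τ hτ i
      have h5 := hF.nonneg τ i
      rw [hc]
      gcongr
  have hmono : ∀ a b, 0 ≤ a → a ≤ b → coverage μ k α (P a) ≤ coverage μ k α (P b) := by
    intro a b ha hab
    have := mul_sub_le_of_hasDerivWithinAt (c := 0) ha hab (fun τ hτ => hderiv τ (ha.trans hτ.1))
      fun τ hτ => Finset.sum_nonneg fun j _ => hterm τ (ha.trans hτ.1) j
    linarith
  have hbdd : BddAbove ((fun τ => coverage μ k α (P τ)) '' Set.Ici 0) := by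
    refine ⟨∑ _j : ι, k * μ.real Set.univ, ?_⟩
    rintro _ ⟨τ, hτ, rfl⟩
    simp only
    rw [← sum_mass_eq_coverage hk hα hA.bisectors (hF.mem_configurations hA hk hα hP0 hinj hτ).2]
    exact Finset.sum_le_sum fun j _ => mass_le hk hα _ _
  have hcτ : 0 < c * τ := by positivity
  -- Coverage comes within `c * τ` of its supremum at `t₀`; a later increment of `c * τ` would
  -- exceed the supremum.
  obtain ⟨_, ⟨t₀, ht₀, rfl⟩, hlt⟩ := exists_lt_of_lt_csSup
    ((Set.nonempty_Ici (a := (0 : ℝ))).image fun τ => coverage μ k α (P τ))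
    (sub_lt_self (sSup ((fun τ => coverage μ k α (P τ)) '' Set.Ici 0)) hcτ)
  obtain ⟨n, ⟨hn1, hn2⟩, hn3⟩ := (hev.and (ht.eventually_ge_atTop (t₀ + τ))).exists
  have h1 := hmono t₀ (t n - τ) ht₀ (by linarith)
  have h2 := le_csSup hbdd (Set.mem_image_of_mem _ (show t n ∈ Set.Ici 0 from hτ.le.trans hn1))
  simp only at hlt h2
  linarith

/-- Trajectories converge to the set of stationary configurations. -/
theorem convergesToSet (hκ : 0 < κ) (hU : ∀ i, 0 < U i) :
    ConvergesToSet P {Q | (∀ i, Q i ∈ K) ∧ Function.Injective Q ∧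
      ∀ i, moment μ k α Q i = 0} := by
  intro ε hε
  by_contra hcon
  push Not at hcon
  choose t ht hfar using fun n : ℕ => hcon n
  have ht_top : Tendsto t atTop atTop := tendsto_atTop_mono ht tendsto_natCast_atTop_atTop
  have hK : IsCompact (Set.univ.pi fun _ : ι => K) := isCompact_univ_pi fun _ => hA.compact
  obtain ⟨Q, hQ, φ, hφ, hlim⟩ := hK.tendsto_subseq (x := fun n => P (t n)) fun n i _ =>
    (hF.mem_configurations hA hk hα hP0 hinj ((Nat.cast_nonneg n).trans (ht n))).1 i
  have ht' : Tendsto (fun n => t (φ n)) atTop atTop := ht_top.comp hφ.tendsto_atTop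
  have hQmem : Q ∈ {Q | (∀ i, Q i ∈ K) ∧ Function.Injective Q ∧ ∀ i, moment μ k α Q i = 0} :=
    ⟨fun i => hQ i trivial, hF.injective_of_tendsto hA hk hα hP0 hinj hκ hU ht' hlim,
      hF.moment_eq_zero_of_tendsto hA hk hα hP0 hinj hκ hU ht' hlim⟩
  obtain ⟨n, hn⟩ := ((tendsto_iff_dist_tendsto_zero.1 hlim).eventually_lt_const hε).exists
  exact absurd (hfar (φ n) Q hQmem) (not_le.2 hn)

end IsCentroidFlow
end Convergence

/-! ### Translation to the density on the polytope -/

section Bridge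

variable {d N : ℕ} {Q : Set (Space d)} {φ : Space d → ℝ} {k α kprop : ℝ}

/-- The measure on `Q` with density `φ`. -/
noncomputable def densityMeasure (Q : Set (Space d)) (φ : Space d → ℝ) : Measure (Space d) :=
  (volume.restrict Q).withDensity fun q => ENNReal.ofReal (φ q)

theorem setIntegral_densityMeasure {F : Type*} [NormedAddCommGroup F] [NormedSpace ℝ F]
    (hQ : MeasurableSet Q) (hφ_meas : AEMeasurable φ (volume.restrict Q))
    (hφ : ∀ q ∈ Q, φ q ∈ Set.Icc (0 : ℝ) 1) (P : Fin N → Space d) (i : Fin N)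
    (g : Space d → F) :
    ∫ q in cell P i, g q ∂(densityMeasure Q φ) = ∫ q in voronoiCell Q P i, φ q • g q := by
  have hcell := measurableSet_cell P i
  rw [densityMeasure, setIntegral_withDensity_eq_setIntegral_toReal_smul₀
    hφ_meas.ennreal_ofReal.restrict (Eventually.of_forall fun q => ENNReal.ofReal_lt_top) g hcell,
    Measure.restrict_restrict hcell, Set.inter_comm]
  have hV : voronoiCell Q P i = Q ∩ cell P i := rfl
  rw [← hV]
  refine setIntegral_congr_fun (hQ.inter hcell) fun q hq => ?_
  rw [ENNReal.toReal_ofReal (hφ q hq.1).1]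

theorem isFiniteMeasure_densityMeasure (hQ : IsCompact Q)
    (hφ : ∀ q ∈ Q, φ q ∈ Set.Icc (0 : ℝ) 1) : IsFiniteMeasure (densityMeasure Q φ) := by
  refine isFiniteMeasure_withDensity (ne_of_lt ?_)
  calc ∫⁻ q in Q, ENNReal.ofReal (φ q) ≤ ∫⁻ _ in Q, 1 := by
        refine setLIntegral_mono' hQ.measurableSet fun q hq => ?_
        simpa using (hφ q hq).2
    _ < ⊤ := by simpa using hQ.measure_lt_top

theorem bisectorsNull_volume : BisectorsNull (volume : Measure (Space d)) := by
  intro x y hxy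
  have h := Measure.addHaar_affineSubspace (volume : Measure (Space d))
    (AffineSubspace.perpBisector x y) (by simpa using hxy)
  convert h using 2
  ext q
  simp [AffineSubspace.mem_perpBisector_iff_dist_eq, dist_eq_norm]

theorem isAdmissible_densityMeasure (hQ : IsCompact Q) (hconv : Convex ℝ Q)
    (hφ_meas : AEMeasurable φ (volume.restrict Q)) (hφ : ∀ q ∈ Q, φ q ∈ Set.Icc (0 : ℝ) 1)
    (hmass : ∀ P ∈ configurations Q N, ∀ i, 0 < ∫ q in voronoiCell Q P i, φ q) :
    IsAdmissible (Fin N) (densityMeasure Q φ) Q where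
  compact := hQ
  convex := hconv
  ae_mem := (withDensity_absolutelyContinuous _ _).ae_le (ae_restrict_mem hQ.measurableSet)
  bisectors := fun x y hxy => (withDensity_absolutelyContinuous _ _)
    (Measure.absolutelyContinuous_of_le Measure.restrict_le_self (bisectorsNull_volume x y hxy))
  cell_pos := fun P hP hPQ i => by
    have h1 := hmass P ⟨hPQ, fun i j hij => hP.ne hij⟩ i
    have h2 := setIntegral_densityMeasure hQ.measurableSet hφ_meas hφ P i fun _ => (1 : ℝ)
    simp only [smul_eq_mul, mul_one] at h2
    rw [← h2] at h1
    simpa using h1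

section

variable (hQ : MeasurableSet Q) (hφ_meas : AEMeasurable φ (volume.restrict Q))
  (hφ : ∀ q ∈ Q, φ q ∈ Set.Icc (0 : ℝ) 1)
include hQ hφ_meas hφ

theorem cellMass_eq (P : Fin N → Space d) (i : Fin N) :
    cellMass Q φ k α P i = mass (densityMeasure Q φ) k α P i :=
  (setIntegral_densityMeasure hQ hφ_meas hφ P i fun q => weight k α (P i - q)).symm

theorem cellCentroid_eq (P : Fin N → Space d) (i : Fin N) :
    cellCentroid Q φ k α P i = centroid (densityMeasure Q φ) k α P i := by
  rw [cellCentroid, centroid, cellMass_eq hQ hφ_meas hφ,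
    setIntegral_densityMeasure hQ hφ_meas hφ P i]
  simp only [smul_smul]
  rfl

theorem objective_eq (P : Fin N → Space d) :
    objective Q φ k α P = ∑ i, mass (densityMeasure Q φ) k α P i := by
  unfold objective
  refine Finset.sum_congr rfl fun i _ => ?_
  rw [← cellMass_eq hQ hφ_meas hφ]
  simp only [beta, sub_sub_cancel]
  rfl

end

theorem mem_configurations_iff {P : Fin N → Space d} :
    P ∈ configurations Q N ↔ (∀ i, P i ∈ Q) ∧ Function.Injective P := by
  refine and_congr_right fun _ => ⟨fun h i j hij => ?_, fun h i j hij => h.ne hij⟩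
  by_contra hne
  exact h i j hne hij

/-- Injectivity is open, so objective and coverage agree near a configuration. Testing the
derivative in the direction of the `i`-th moment gives `2 * α` times its squared norm. -/
theorem criticalPoints_eq (hQ : IsCompact Q) (hA : IsAdmissible (Fin N) (densityMeasure Q φ) Q)
    (hφ_meas : AEMeasurable φ (volume.restrict Q)) (hφ : ∀ q ∈ Q, φ q ∈ Set.Icc (0 : ℝ) 1)
    (hk : 0 < k) (hα : 0 < α) :
    criticalPoints Q N φ k α = {P | (∀ i, P i ∈ Q) ∧ Function.Injective P ∧
      ∀ i, moment (densityMeasure Q φ) k α P i = 0} := by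
  have := isFiniteMeasure_densityMeasure hQ hφ
  ext P
  simp only [criticalPoints, Set.mem_ofPred_eq, mem_configurations_iff, and_assoc]
  refine and_congr_right fun _ => and_congr_right fun hinj => ?_
  have hd : HasFDerivAt (objective Q φ k α)
      (∑ i, ((2 * α) • innerSL ℝ (moment (densityMeasure Q φ) k α P i)).comp
        (ContinuousLinearMap.proj (R := ℝ) (φ := fun _ : Fin N => Space d) i)) P := by
    refine (hasFDerivAt_coverage hk hα hA.compact hA.ae_mem hA.bisectors
      hinj).congr_of_eventuallyEq ?_
    filter_upwards [eventually_injective hinj] with P' hP'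
    rw [objective_eq hQ.measurableSet hφ_meas hφ, sum_mass_eq_coverage hk hα hA.bisectors hP']
  constructor
  · intro h i
    have h1 := congrArg (fun L : (Fin N → Space d) →L[ℝ] ℝ =>
      L (Pi.single i (moment (densityMeasure Q φ) k α P i))) (hd.unique h)
    simp only [sum_apply, ContinuousLinearMap.comp_apply, ContinuousLinearMap.proj_apply,
      smul_apply, innerSL_apply_apply, smul_eq_mul, zero_apply] at h1
    rw [Finset.sum_eq_single i (fun j _ hj => by simp [Pi.single_eq_of_ne hj]) (by simp),
      Pi.single_eq_same, real_inner_self_eq_norm_sq] at h1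
    have h2 : ‖moment (densityMeasure Q φ) k α P i‖ ^ 2 = 0 :=
      (mul_eq_zero.1 h1).resolve_left (by positivity)
    simpa using h2
  · intro h
    refine hd.congr_fderiv ?_
    refine Finset.sum_eq_zero fun i _ => ?_
    rw [h i]
    simp

theorem centroidalConfigurations_eq (hQ : IsCompact Q)
    (hA : IsAdmissible (Fin N) (densityMeasure Q φ) Q)
    (hφ_meas : AEMeasurable φ (volume.restrict Q)) (hφ : ∀ q ∈ Q, φ q ∈ Set.Icc (0 : ℝ) 1)
    (hk : 0 < k) (hα : 0 < α) :
    centroidalConfigurations Q N φ k α = {P | (∀ i, P i ∈ Q) ∧ Function.Injective P ∧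
      ∀ i, moment (densityMeasure Q φ) k α P i = 0} := by
  have := isFiniteMeasure_densityMeasure hQ hφ
  ext P
  simp only [centroidalConfigurations, Set.mem_ofPred_eq, mem_configurations_iff, and_assoc]
  refine and_congr_right fun hPQ => and_congr_right fun hinj => forall_congr' fun i => ?_
  have hm := (mass_pos hk hα (hA.cell_pos P hinj hPQ i)).ne'
  rw [cellCentroid_eq hQ.measurableSet hφ_meas hφ, moment_eq hA.compact hA.ae_mem hm,
    smul_eq_zero, or_iff_right hm, sub_eq_zero, eq_comm]

/-- The saturated control law is a proportional law with a state-dependent gain. -/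
theorem exists_saturatedControl_eq {U : ℝ} (hkprop : 0 < kprop) (hU : 0 < U) (p c : Space d) :
    ∃ s, saturatedControl kprop U p c = s • (c - p) ∧ 0 ≤ s ∧ s ≤ kprop ∧ ‖s • (c - p)‖ ≤ U ∧
      ∀ D, 0 < D → ‖c - p‖ ≤ D → min kprop (U / D) ≤ s := by
  have h1 : ∀ r : ℝ, -r • (p - c) = r • (c - p) := fun r => by module
  unfold saturatedControl
  simp only [h1]
  split_ifs with h
  · exact ⟨kprop, rfl, hkprop.le, le_rfl, h, fun D _ _ => min_le_left _ _⟩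
  · push Not at h
    rw [norm_smul, Real.norm_of_nonneg hkprop.le] at h
    have h2 : 0 < ‖c - p‖ := by
      by_contra h3
      have h4 : ‖c - p‖ = 0 := le_antisymm (not_lt.1 h3) (norm_nonneg _)
      rw [h4] at h
      linarith
    rw [norm_sub_rev p c]
    refine ⟨U / ‖c - p‖, rfl, by positivity, ?_, ?_, fun D hD hcD => (min_le_right _ _).trans ?_⟩
    · rw [div_le_iff₀ h2]
      exact h.le
    · rw [norm_smul, Real.norm_of_nonneg (by positivity), div_mul_cancel₀ _ h2.ne']
    · gcongr

/-- The gains are chosen separately at each time; their bounds suffice, and no regularity in time is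
required. -/
theorem IsSaturatedTrajectory.exists_isCentroidFlow (hQ : MeasurableSet Q)
    (hφ_meas : AEMeasurable φ (volume.restrict Q)) (hφ : ∀ q ∈ Q, φ q ∈ Set.Icc (0 : ℝ) 1)
    (hkprop : 0 < kprop) {Umax : Fin N → ℝ} (hU : ∀ i, 0 < Umax i) {P : ℝ → Fin N → Space d}
    (hP : IsSaturatedTrajectory Q φ k α kprop Umax P) :
    ∃ s, IsCentroidFlow (densityMeasure Q φ) k α kprop Umax P s := by
  choose s hs using fun (t : ℝ) (i : Fin N) => exists_saturatedControl_eq hkprop (hU i) (P t i)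
    (centroid (densityMeasure Q φ) k α (P t) i)
  refine ⟨s, fun t ht i => ?_, fun t i => (hs t i).2.1, fun t i => (hs t i).2.2.1,
    fun t i => (hs t i).2.2.2.1, fun t i => (hs t i).2.2.2.2⟩
  have h := hP t ht i
  rwa [cellCentroid_eq hQ hφ_meas hφ, (hs t i).1] at h

end Bridge
end MultiRobotSearch

theorem mainTheorem2 {d N : ℕ} (Q : Set (MultiRobotSearch.Space d))
    (hQ : MultiRobotSearch.IsConvexPolytope Q)
    (φ : MultiRobotSearch.Space d → ℝ)
    (hφ_meas : AEMeasurable φ (volume.restrict Q))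
    (hφ : ∀ q ∈ Q, φ q ∈ Set.Icc (0 : ℝ) 1)
    (k α kprop : ℝ) (hk : k ∈ Set.Ioo (0 : ℝ) 1) (hα : 0 < α) (hkprop : 0 < kprop)
    (Umax : Fin N → ℝ) (hUmax : ∀ i, 0 < Umax i)
    -- the centroids of the Voronoi cells of configurations are defined
    (hmass : ∀ P ∈ MultiRobotSearch.configurations Q N, ∀ i,
      0 < ∫ q in MultiRobotSearch.voronoiCell Q P i, φ q) :
    MultiRobotSearch.criticalPoints Q N φ k α =
        MultiRobotSearch.centroidalConfigurations Q N φ k α ∧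
      ∀ P : ℝ → Fin N → MultiRobotSearch.Space d,
        P 0 ∈ MultiRobotSearch.configurations Q N →
        MultiRobotSearch.IsSaturatedTrajectory Q φ k α kprop Umax P →
        MultiRobotSearch.ConvergesToSet P (MultiRobotSearch.criticalPoints Q N φ k α) := by
  obtain ⟨S, hS, rfl⟩ := hQ
  have hcpt : IsCompact (convexHull ℝ S) := hS.isCompact_convexHull ℝ
  have := MultiRobotSearch.isFiniteMeasure_densityMeasure hcpt hφ
  have hA := MultiRobotSearch.isAdmissible_densityMeasure hcpt (convex_convexHull ℝ S) hφ_meas hφ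
    hmass
  rw [MultiRobotSearch.criticalPoints_eq hcpt hA hφ_meas hφ hk.1 hα,
    MultiRobotSearch.centroidalConfigurations_eq hcpt hA hφ_meas hφ hk.1 hα]
  refine ⟨rfl, fun P hP0 hP => ?_⟩
  obtain ⟨s, hs⟩ := hP.exists_isCentroidFlow hcpt.measurableSet hφ_meas hφ hkprop hUmax
  rw [MultiRobotSearch.mem_configurations_iff] at hP0
  exact hs.convergesToSet hA hk.1 hα hP0.1 hP0.2 hkprop hUmax
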